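/- **Setting.** Consider a finite normal-form game with $N\ge 1$ players, non-empty finite action sets $\mathcal A_1,\dots,\mathcal A_N$, $A=\max_i|\mathcal A_i|$, and utilities $u_i:\prod_j\mathcal A_j\to[0,1]$ that are unknown to the players. Each play of the game is one sample: an action profile $a$ is played, and each player $i$ receives a random payoff $U_i\in[0,1]$ whose conditional mean, given the past and $a$, is $u_i(a)$. Let $\epsilon,\Delta\in(0,1]$ and $\delta\in(0,1)$. **Rationalizability.** Let $E_0=\emptyset$. For $l\ge 1$, let $E_l$ be the set of all actions $a\in\mathcal A_i$, $i\in[N]$, for which there is a distribution $x$ on $\mathcal A_i$ with $u_i(a,a_{-i})\le u_i(x,a_{-i})-\Delta$ for every $a_{-i}$ that contains no action of $E_{l-1}$. Let $L=\min\{l\ge 1: E_{l+1}=E_l\}$. An action is *$\Delta$-rationalizable* if it is not in $E_L$. A distribution $\Pi$ on $\prod_j\mathcal A_j$ is an *$\epsilon$-CCE* if $\mathbb E_{a\sim\Pi}[u_i(a)]\ge \mathbb E_{a\sim\Pi}[u_i(a',a_{-i})]-\epsilon$ for all $i$ and all $a'\in\mathcal A_i$. **Algorithm, with $T$ rounds.**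 Put $p=\frac{\min\{\epsilon,\Delta\}}{8AN}$, and for $t\ge 1$ $$\eta_t=\max\Big\{\sqrt{\tfrac{\ln A}{t}},\ \tfrac{4\ln(1/p)}{\Delta t}\Big\},\qquad M_t=\Big\lceil\tfrac{64\ln(ANT/\delta)}{\Delta^2t}\Big\rceil,\qquad M=\Big\lceil\tfrac{64\ln(LNA/\delta)}{\Delta^2}\Big\rceil .$$ 1. (Iterative best response.) Choose a profile $a^{(0)}$ arbitrarily. For $l=1,\dots,L$ and each player $i$: for every $a\in\mathcal A_i$, play $(a,a_{-i}^{(l-1)})$ $M$ times, and let $a_i^{(l)}$ be an action with the highest average payoff of player $i$ (ties broken arbitrarily). 2. (Hedge.) Let $\theta_i^{(1)}$ be the point mass at $a_i^{(L)}$. For $t=1,\dots,T$ and each player $i$: for every $a\in\mathcal A_i$, play $M_t$ times with player $i$ playing $a$ and the other players drawing their actions independently from $\theta_j^{(t)}$, $j\ne i$; let $u_i^{(t)}(a)$ be player $i$'s average payoff; and set $\theta_i^{(t+1)}(\cdot)\propto\exp\big(\eta_t\sum_{\tau=1}^t u_i^{(\tau)}(\cdot)\big)$. 3. (Clipping.)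 For all $t\in[T]$ and $i\in[N]$, remove from $\theta_i^{(t)}$ all actions with probability smaller than $p$ and renormalize, which gives $\bar\theta_i^{(t)}$. Output $\Pi=\frac1T\sum_{t=1}^T\bigotimes_{i=1}^N\bar\theta_i^{(t)}$. **Theorem.** There are universal constants $C>0$ and $k\in\mathbb N$, and a number of rounds $T_0=T_0(N,A,\epsilon,\Delta,\delta)\in\mathbb N$ with $$T_0\le C\,\ln^k\!\Big(\frac{2NA}{\epsilon\Delta\delta}\Big)\Big(\frac1{\epsilon^2}+\frac1{\epsilon\Delta}\Big),$$ such that, for every game and all $\epsilon,\Delta,\delta$ as above: for every $T\ge T_0$, with probability at least $1-3\delta$, the output $\Pi$ of the algorithm with $T$ rounds is an $\epsilon$-CCE whose support contains only profiles of $\Delta$-rationalizable actions; and the total number of samples used by the algorithm with $T=T_0$ is at most $$C\,\ln^k\!\Big(\frac{2NAL}{\epsilon\Delta\delta}\Big)\Big(\frac{LNA}{\Delta^2}+\frac{NA}{\epsilon^2}\Big).$$ -/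

import Mathlib

open MeasureTheory Finset

noncomputable section

namespace RationalizableCCE

universe u v

/-- A finite normal-form game with players `Fin N`, action sets `A i`, and utilities in `[0,1]`. -/
structure Game {N : ℕ} (A : Fin N → Type u) where
  /-- `util i b` is the expected payoff of player `i` under the action profile `b`. -/
  util : Fin N → (∀ j, A j) → ℝ
  util_mem : ∀ i b, util i b ∈ Set.Icc (0 : ℝ) 1

section Preliminaries

variable {N : ℕ} {A : Fin N → Type u}

/-- The maximum number of actions of a player. -/
def maxActions (A : Fin N → Type u) [∀ i, Fintype (A i)] : ℕ :=
  Finset.univ.sup fun i => Fintype.card (A i)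

/-- The set `E_l` of actions (of all players) eliminated within `l` rounds of iterated
`Δ`-dominance elimination, with `E_0 = ∅`. -/
def elim [∀ i, Fintype (A i)] (G : Game A) (Δ : ℝ) : ℕ → Set (Σ i, A i)
  | 0 => ∅
  | l + 1 => {p | ∃ x ∈ stdSimplex ℝ (A p.1), ∀ b : ∀ j, A j,
      (∀ j, j ≠ p.1 → (⟨j, b j⟩ : Σ i, A i) ∉ elim G Δ l) →
        G.util p.1 (Function.update b p.1 p.2)
          ≤ (∑ a, x a * G.util p.1 (Function.update b p.1 a)) - Δ}

/-- The minimum elimination length `L`, the least `l ≥ 1` with `E_{l+1} = E_l`. -/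
def elimLength [∀ i, Fintype (A i)] (G : Game A) (Δ : ℝ) : ℕ :=
  sInf {l | 1 ≤ l ∧ elim G Δ (l + 1) = elim G Δ l}

/-- The action `a` of player `i` is `Δ`-rationalizable. -/
def Rationalizable [∀ i, Fintype (A i)] (G : Game A) (Δ : ℝ) (i : Fin N) (a : A i) : Prop :=
  (⟨i, a⟩ : Σ i, A i) ∉ elim G Δ (elimLength G Δ)

/-- The correlated strategy `P` (a distribution on action profiles) is an `ε`-CCE. -/
def IsCCE [∀ i, Fintype (A i)] (G : Game A) (ε : ℝ) (P : (∀ j, A j) → ℝ) : Prop :=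
  P ∈ stdSimplex ℝ (∀ j, A j) ∧
    ∀ (i : Fin N) (a : A i),
      (∑ b, P b * G.util i (Function.update b i a)) - ε ≤ ∑ b, P b * G.util i b

/-- `P` plays only `Δ`-rationalizable actions. -/
def PlaysRationalizable [∀ i, Fintype (A i)] (G : Game A) (Δ : ℝ) (P : (∀ j, A j) → ℝ) : Prop :=
  ∀ b, P b ≠ 0 → ∀ i, Rationalizable G Δ i (b i)

end Preliminaries

section Parameters

/-- The clipping threshold `p` (`n` players, at most `m` actions each). -/
def clipThreshold (n m : ℕ) (ε Δ : ℝ) : ℝ := min ε Δ / (8 * m * n)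

/-- The learning rate `η_t`, `t ≥ 1`. -/
def learningRate (n m : ℕ) (ε Δ : ℝ) (t : ℕ) : ℝ :=
  max (Real.sqrt (Real.log m / t)) (4 * Real.log (1 / clipThreshold n m ε Δ) / (Δ * t))

/-- The minibatch size `M_t`, `t ≥ 1`, of the Hedge phase with `T` rounds. -/
def batchSize (n m : ℕ) (Δ δ : ℝ) (T t : ℕ) : ℕ :=
  ⌈64 * Real.log (m * n * T / δ) / (Δ ^ 2 * t)⌉₊

/-- The batch size of the iterative best response subroutine with `L` rounds. -/
def initBatchSize (n m L : ℕ) (Δ δ : ℝ) : ℕ :=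
  ⌈64 * Real.log (L * n * m / δ) / Δ ^ 2⌉₊

end Parameters

section Algorithm

variable {N : ℕ} {A : Fin N → Type u} [∀ i, Fintype (A i)]

/-- The plays (samples) made by the algorithm with `T` Hedge rounds. `Sum.inl (l, ⟨i, a⟩, m)` is the
`m`-th play of action `a` by the exploring player `i` in round `l + 1` of iterative best response;
`Sum.inr ⟨t, ⟨i, a⟩, m⟩` is the `m`-th play of action `a` by the exploring player `i` in round
`t + 1` of the Hedge phase. -/
abbrev Slot (G : Game A) (Δ δ : ℝ) (T : ℕ) : Type u :=
  (Fin (elimLength G Δ) × (Σ i, A i) ×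
      Fin (initBatchSize N (maxActions A) (elimLength G Δ) Δ δ)) ⊕
    (Σ t : Fin T, (Σ i, A i) × Fin (batchSize N (maxActions A) Δ δ T (t + 1)))

/-- The total number of samples (joint plays of the game) used by the algorithm. -/
def sampleCount (G : Game A) (Δ δ : ℝ) (T : ℕ) : ℕ := Fintype.card (Slot G Δ δ T)

variable {G : Game A} {Δ δ : ℝ} {T : ℕ}

/-- The index of the round (best response rounds first, then Hedge rounds) of a play. -/
def Slot.round : Slot G Δ δ T → ℕ
  | Sum.inl (l, _, _) => l
  | Sum.inr ⟨t, _, _⟩ => elimLength G Δ + t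

/-- The exploring player of a play, with the action that this player tries. -/
def Slot.explored : Slot G Δ δ T → Σ i, A i
  | Sum.inl (_, p, _) => p
  | Sum.inr ⟨_, p, _⟩ => p

/-- The average payoff of action `p.2` of player `p.1` in best response round `l + 1`, where `r s`
is the payoff received by the exploring player in play `s`. -/
def initAverage (r : Slot G Δ δ T → ℝ) (l : Fin (elimLength G Δ)) (p : Σ i, A i) : ℝ :=
  (∑ m, r (Sum.inl (l, p, m))) / initBatchSize N (maxActions A) (elimLength G Δ) Δ δ

/-- The average payoff `u_i^{(t+1)}(a)`, `p = ⟨i, a⟩`, in Hedge round `t + 1`. -/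
def hedgeAverage (r : Slot G Δ δ T → ℝ) (t : Fin T) (p : Σ i, A i) : ℝ :=
  (∑ m, r (Sum.inr ⟨t, p, m⟩)) / batchSize N (maxActions A) Δ δ T (t + 1)

/-- The point mass at `a`, as a mixed strategy. -/
def pointMass {B : Type u} (a : B) : B → ℝ := by
  classical exact fun b => if b = a then 1 else 0

/-- The Hedge strategies: `hedge ε astar r t i` is the mixed strategy `θ_i^{(t+1)}`, namely the
point mass at `astar i` for `t = 0`, and proportional to
`exp (η_t * (u_i^{(1)} + ⋯ + u_i^{(t)}))` for `t ≥ 1`. -/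
def hedge (ε : ℝ) (astar : ∀ j, A j) (r : Slot G Δ δ T → ℝ) : ℕ → ∀ i, A i → ℝ
  | 0, i, a => pointMass (astar i) a
  | t + 1, i, a =>
      let w : A i → ℝ := fun a' => Real.exp (learningRate N (maxActions A) ε Δ (t + 1) *
        ∑ τ ∈ Finset.univ.filter (fun τ : Fin T => (τ : ℕ) < t + 1), hedgeAverage r τ ⟨i, a'⟩)
      w a / ∑ a', w a'

/-- Remove the actions with probability smaller than `p`, and renormalize. -/
def clip {B : Type u} [Fintype B] (p : ℝ) (x : B → ℝ) (a : B) : ℝ :=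
  if x a < p then 0 else x a / ∑ b with p ≤ x b, x b

/-- The output: the average over the `T` rounds of the products of the clipped strategies. -/
def output (ε : ℝ) (astar : ∀ j, A j) (r : Slot G Δ δ T → ℝ) (b : ∀ j, A j) : ℝ :=
  (∑ t ∈ Finset.range T,
    ∏ i, clip (clipThreshold N (maxActions A) ε Δ) (hedge ε astar r t i) (b i)) / T

/-- The mixed strategies that the non-exploring players use in play `s`: in best response round
`l + 1` the pure profile `prof l`, and in Hedge round `t + 1` the strategies `θ^{(t+1)}`,
initialized at the result `prof L` of the best response phase. -/
def strategyAt (ε : ℝ) (prof : ℕ → ∀ j, A j) (r : Slot G Δ δ T → ℝ) :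
    Slot G Δ δ T → ∀ i, A i → ℝ
  | Sum.inl (l, _, _) => fun i => pointMass (prof l i)
  | Sum.inr ⟨t, _, _⟩ => hedge ε (prof (elimLength G Δ)) r t

/-- The probability of the profile `b` when player `p.1` plays `p.2` and the other players draw
their actions independently from the mixed strategies `x`. -/
def explorationLaw (x : ∀ j, A j → ℝ) (p : Σ i, A i) (b : ∀ j, A j) : ℝ := by
  classical exact if b p.1 = p.2 then ∏ j ∈ Finset.univ.erase p.1, x j (b j) else 0

/-- A run, on a probability space `(Ω, μ)`, of the algorithm with target accuracies `ε` and `Δ`,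
confidence parameter `δ` and `T` Hedge rounds, in the game `G` under bandit feedback. The players
do not see `G`: they use only the payoffs that they receive. -/
structure Run (G : Game A) (ε Δ δ : ℝ) (T : ℕ) {Ω : Type v} [mΩ : MeasurableSpace Ω]
    (μ : Measure Ω) where
  /-- The order in which the plays are made. -/
  time : Slot G Δ δ T ≃ Fin (sampleCount G Δ δ T)
  /-- Rounds are made one after the other; the order within a round is arbitrary. -/
  time_lt : ∀ s s', Slot.round s < Slot.round s' → time s < time s'
  /-- The information available before the play made at time `k`. -/
  history : Filtration ℕ mΩ
  /-- The action profile played. -/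
  act : Slot G Δ δ T → Ω → ∀ j, A j
  /-- The payoffs received: `fb s ω i` is the random feedback `U_i` of player `i` in play `s`. -/
  fb : Slot G Δ δ T → Ω → Fin N → ℝ
  /-- `prof l` is the profile of the best response phase after `l` rounds; `prof 0` is arbitrary. -/
  prof : ℕ → Ω → ∀ j, A j
  act_adapted : ∀ s b, MeasurableSet[history ((time s : ℕ) + 1)] {ω | act s ω = b}
  fb_adapted : ∀ s i, Measurable[history ((time s : ℕ) + 1)] fun ω => fb s ω i
  /-- The profile `prof l` is chosen before any later round starts. -/
  prof_adapted : ∀ s l, l ≤ elimLength G Δ → l ≤ Slot.round s →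
    ∀ b, MeasurableSet[history (time s)] {ω | prof l ω = b}
  fb_mem : ∀ s ω i, fb s ω i ∈ Set.Icc (0 : ℝ) 1
  /-- Bandit feedback: given the past and the profile just played, `U_i` has mean `u_i`. -/
  fb_mean : ∀ s i,
    μ[fun ω => fb s ω i |
        history (time s) ⊔ MeasurableSpace.comap (act s) (⊤ : MeasurableSpace (∀ j, A j))]
      =ᵐ[μ] fun ω => G.util i (act s ω)
  /-- Iterative best response: each player moves to an empirical best response, with ties broken
  arbitrarily. -/
  prof_best : ∀ (l : Fin (elimLength G Δ)) (ω : Ω) (i : Fin N) (a : A i),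
    initAverage (fun s => fb s ω (Slot.explored s).1) l ⟨i, a⟩
      ≤ initAverage (fun s => fb s ω (Slot.explored s).1) l ⟨i, prof (l + 1) ω i⟩
  /-- Given the past, the profile of play `s` is drawn as the algorithm prescribes. -/
  act_law : ∀ s b,
    μ[Set.indicator {ω | act s ω = b} (fun _ => (1 : ℝ)) | history (time s)]
      =ᵐ[μ] fun ω => explorationLaw
        (strategyAt ε (fun l => prof l ω) (fun s' => fb s' ω (Slot.explored s').1) s)
        (Slot.explored s) b

/-- The correlated strategy that the run outputs. -/
def Run.result {ε : ℝ} {Ω : Type v} [MeasurableSpace Ω] {μ : Measure Ω}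
    (R : Run G ε Δ δ T μ) (ω : Ω) : (∀ j, A j) → ℝ :=
  output ε (R.prof (elimLength G Δ) ω) fun s => R.fb s ω (Slot.explored s).1

end Algorithm

end RationalizableCCE

end

noncomputable section

namespace RationalizableCCE

universe u v

section Concentration

variable {Ω : Type*} {m mΩ : MeasurableSpace Ω} {μ : Measure Ω}

/-- The chord bound for the exponential on `[-1, 1]`. -/
lemma exp_mul_le_cosh_add_mul_sinh (s : ℝ) {d : ℝ} (h₁ : -1 ≤ d) (h₂ : d ≤ 1) :
    Real.exp (s * d) ≤ Real.cosh s + d * Real.sinh s := by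
  have h := convexOn_exp.2 (Set.mem_univ s) (Set.mem_univ (-s))
    (show 0 ≤ (1 + d) / 2 by linarith) (show 0 ≤ (1 - d) / 2 by linarith) (by ring)
  simp only [smul_eq_mul] at h
  rw [show (1 + d) / 2 * s + (1 - d) / 2 * -s = s * d by ring] at h
  rw [Real.cosh_eq, Real.sinh_eq]
  linarith

lemma integral_mul_sub_condExp_eq_zero [IsFiniteMeasure μ] (hm : m ≤ mΩ)
    {X Y : Ω → ℝ} (hX : Integrable X μ) (hY : StronglyMeasurable[m] Y) {B : ℝ}
    (hB : ∀ᵐ ω ∂μ, ‖Y ω‖ ≤ B) :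
    ∫ ω, Y ω * (X ω - (μ[X | m]) ω) ∂μ = 0 := by
  have hYm : AEStronglyMeasurable Y μ := (hY.mono hm).aestronglyMeasurable
  have h₁ : Integrable (fun ω => Y ω * X ω) μ := hX.bdd_mul hYm hB
  have h₂ : Integrable (fun ω => Y ω * (μ[X | m]) ω) μ := integrable_condExp.bdd_mul hYm hB
  have h₃ : μ[Y * X | m] =ᵐ[μ] Y * μ[X | m] := condExp_mul_of_stronglyMeasurable_left hY h₁ hX
  simp_rw [mul_sub]
  rw [integral_sub h₁ h₂, sub_eq_zero, ← integral_condExp hm (f := fun ω => Y ω * X ω)]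
  exact integral_congr_ae h₃

lemma ae_abs_sub_condExp_le_one [IsProbabilityMeasure μ] (hm : m ≤ mΩ)
    {X : Ω → ℝ} (hXm : Measurable X) (hX : ∀ ω, X ω ∈ Set.Icc (0 : ℝ) 1) :
    ∀ᵐ ω ∂μ, |X ω - (μ[X | m]) ω| ≤ 1 := by
  have hi : Integrable X μ := Integrable.of_bound hXm.aestronglyMeasurable 1
    (.of_forall fun ω => by rw [Real.norm_eq_abs, abs_of_nonneg (hX ω).1]; exact (hX ω).2)
  have h₀ := condExp_mono (m := m) (integrable_const (0 : ℝ)) hi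
    (.of_forall fun ω => (hX ω).1)
  have h₁ := condExp_mono (m := m) hi (integrable_const (1 : ℝ))
    (.of_forall fun ω => (hX ω).2)
  rw [condExp_const hm] at h₀ h₁
  filter_upwards [h₀, h₁] with ω h₀ h₁
  have := hX ω
  rw [abs_le]
  constructor <;> linarith [this.1, this.2]

variable [IsProbabilityMeasure μ]

/-- The exponential supermartingale of a weighted sum of martingale differences. -/
lemma integral_exp_sum_le_one (F : Filtration ℕ mΩ) {X w : ℕ → Ω → ℝ}
    (hXm : ∀ k, Measurable[F (k + 1)] (X k)) (hX : ∀ k ω, X k ω ∈ Set.Icc (0 : ℝ) 1)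
    (hwm : ∀ k, Measurable[F k] (w k)) {B : ℝ} (hB : ∀ k ω, |w k ω| ≤ B) (n : ℕ) :
    Integrable (fun ω => Real.exp (∑ k ∈ range n,
        (w k ω * (X k ω - (μ[X k | F k]) ω) - w k ω ^ 2 / 2))) μ ∧
      ∫ ω, Real.exp (∑ k ∈ range n,
        (w k ω * (X k ω - (μ[X k | F k]) ω) - w k ω ^ 2 / 2)) ∂μ ≤ 1 := by
  have hD : ∀ k, ∀ᵐ ω ∂μ, |X k ω - (μ[X k | F k]) ω| ≤ 1 := fun k =>
    ae_abs_sub_condExp_le_one (F.le k) ((hXm k).mono (F.le _) le_rfl) (hX k)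
  have hXi : ∀ k, Integrable (X k) μ := fun k => Integrable.of_bound
    ((hXm k).mono (F.le _) le_rfl).aestronglyMeasurable 1
    (.of_forall fun ω => by rw [Real.norm_eq_abs, abs_of_nonneg (hX k ω).1]; exact (hX k ω).2)
  have hmeas : ∀ n, Measurable[F n] (fun ω => Real.exp (∑ k ∈ range n,
      (w k ω * (X k ω - (μ[X k | F k]) ω) - w k ω ^ 2 / 2))) := by
    intro n
    refine Real.measurable_exp.comp (Finset.measurable_fun_sum _ fun k hk => ?_)
    have hk' : k < n := Finset.mem_range.1 hk
    have h₁ : Measurable[F n] (X k) := (hXm k).mono (F.mono hk') le_rfl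
    have h₂ : Measurable[F n] (w k) := (hwm k).mono (F.mono hk'.le) le_rfl
    have h₃ : Measurable[F n] (μ[X k | F k]) :=
      (stronglyMeasurable_condExp.measurable).mono (F.mono hk'.le) le_rfl
    exact (h₂.mul (h₁.sub h₃)).sub ((h₂.pow_const 2).div_const 2)
  have hbdd : ∀ n, ∀ᵐ ω ∂μ, ‖Real.exp (∑ k ∈ range n,
      (w k ω * (X k ω - (μ[X k | F k]) ω) - w k ω ^ 2 / 2))‖ ≤ Real.exp (n * B) := by
    intro n
    filter_upwards [ae_all_iff.2 hD] with ω hω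
    rw [Real.norm_eq_abs, Real.abs_exp, Real.exp_le_exp]
    calc _ ≤ ∑ k ∈ range n, B := Finset.sum_le_sum fun k _ => by
          have h₁ : w k ω * (X k ω - (μ[X k | F k]) ω) ≤ |w k ω| * 1 :=
            (le_abs_self _).trans (by rw [abs_mul]; gcongr; exact hω k)
          nlinarith [hB k ω, sq_nonneg (w k ω)]
      _ = n * B := by simp
  have hint : ∀ n, Integrable (fun ω => Real.exp (∑ k ∈ range n,
      (w k ω * (X k ω - (μ[X k | F k]) ω) - w k ω ^ 2 / 2))) μ := fun n =>
    Integrable.of_bound ((hmeas n).mono (F.le n) le_rfl).aestronglyMeasurable _ (hbdd n)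
  refine ⟨hint n, ?_⟩
  induction n with
  | zero => simp
  | succ n ih =>
    refine le_trans ?_ ih
    set Z : Ω → ℝ := fun ω => Real.exp (∑ k ∈ range n,
      (w k ω * (X k ω - (μ[X k | F k]) ω) - w k ω ^ 2 / 2)) with hZ
    set Y : Ω → ℝ := fun ω => Z ω * (Real.exp (-(w n ω ^ 2 / 2)) * Real.sinh (w n ω)) with hYdef
    have hYm : StronglyMeasurable[F n] Y := by
      refine Measurable.stronglyMeasurable ((hmeas n).mul (Measurable.mul ?_ ?_))
      · exact Real.measurable_exp.comp (((hwm n).pow_const 2).div_const 2).neg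
      · exact Real.continuous_sinh.measurable.comp (hwm n)
    have hYb : ∀ᵐ ω ∂μ, ‖Y ω‖ ≤ Real.exp (n * B) * 1 := by
      filter_upwards [hbdd n] with ω hω
      rw [hYdef, norm_mul]
      gcongr
      rw [norm_mul, Real.norm_eq_abs, Real.abs_exp, Real.norm_eq_abs, Real.abs_sinh]
      have h₁ : Real.sinh |w n ω| ≤ Real.cosh |w n ω| := (Real.sinh_lt_cosh _).le
      have h₂ := Real.cosh_le_exp_half_sq |w n ω|
      rw [sq_abs] at h₂
      calc _ ≤ Real.exp (-(w n ω ^ 2 / 2)) * Real.exp (w n ω ^ 2 / 2) := by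
            gcongr; exact h₁.trans h₂
        _ = 1 := by rw [← Real.exp_add]; simp
    have h0 := integral_mul_sub_condExp_eq_zero (F.le n) (hXi n) hYm hYb
    have hYi : Integrable (fun ω => Y ω * (X n ω - (μ[X n | F n]) ω)) μ :=
      ((hXi n).sub integrable_condExp).bdd_mul (hYm.mono (F.le n)).aestronglyMeasurable hYb
    calc _ ≤ ∫ ω, (Z ω + Y ω * (X n ω - (μ[X n | F n]) ω)) ∂μ := by
          refine integral_mono_ae (hint (n + 1)) ((hint n).add hYi) ?_
          filter_upwards [hD n] with ω hω
          have h₁ := exp_mul_le_cosh_add_mul_sinh (w n ω) (abs_le.1 hω).1 (abs_le.1 hω).2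
          have h₂ := Real.cosh_le_exp_half_sq (w n ω)
          have h₃ : Real.exp (-(w n ω ^ 2 / 2)) * Real.exp (w n ω ^ 2 / 2) = 1 := by
            rw [← Real.exp_add]; simp
          have hZ0 : 0 < Z ω := Real.exp_pos _
          have he0 := Real.exp_pos (-(w n ω ^ 2 / 2))
          rw [Finset.sum_range_succ, Real.exp_add, sub_eq_add_neg (w n ω * _), Real.exp_add]
          change Z ω * _ ≤ Z ω + Z ω * _ * _
          calc _ ≤ Z ω * ((Real.exp (w n ω ^ 2 / 2) +
                  (X n ω - (μ[X n | F n]) ω) * Real.sinh (w n ω)) *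
                  Real.exp (-(w n ω ^ 2 / 2))) := by gcongr; linarith
            _ = _ := by linear_combination Z ω * h₃
      _ = ∫ ω, Z ω ∂μ := by rw [integral_add (hint n) hYi, h0, add_zero]

/-- The Azuma–Hoeffding inequality for `[0,1]`-valued observations with predictable weights. -/
theorem measure_weighted_sum_ge_le (F : Filtration ℕ mΩ) {X w : ℕ → Ω → ℝ}
    (hXm : ∀ k, Measurable[F (k + 1)] (X k)) (hX : ∀ k ω, X k ω ∈ Set.Icc (0 : ℝ) 1)
    (hwm : ∀ k, Measurable[F k] (w k)) {n : ℕ} {V : ℝ} (hV : 0 < V)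
    (hw : ∀ k ω, w k ω ^ 2 ≤ V) (hwV : ∀ ω, ∑ k ∈ range n, w k ω ^ 2 ≤ V) {c : ℝ} (hc : 0 ≤ c) :
    μ {ω | c ≤ ∑ k ∈ range n, w k ω * (X k ω - (μ[X k | F k]) ω)}
      ≤ ENNReal.ofReal (Real.exp (-(c ^ 2 / (2 * V)))) := by
  set s : ℝ := c / V with hs
  have hs0 : 0 ≤ s := div_nonneg hc hV.le
  obtain ⟨hint, hle⟩ := integral_exp_sum_le_one (μ := μ) F hXm hX
    (w := fun k ω => s * w k ω) (fun k => (hwm k).const_mul s) (B := s * √V)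
    (fun k ω => by
      rw [abs_mul, abs_of_nonneg hs0]
      gcongr
      exact Real.abs_le_sqrt (hw k ω)) n
  set Z : Ω → ℝ := fun ω => Real.exp (∑ k ∈ range n,
    (s * w k ω * (X k ω - (μ[X k | F k]) ω) - (s * w k ω) ^ 2 / 2)) with hZ
  set b : ℝ := Real.exp (c ^ 2 / (2 * V)) with hb
  have hb0 : 0 < b := Real.exp_pos _
  have hsub : {ω | c ≤ ∑ k ∈ range n, w k ω * (X k ω - (μ[X k | F k]) ω)} ⊆ {ω | b ≤ Z ω} := by
    intro ω hω
    simp only [Set.mem_ofPred_eq] at hω ⊢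
    rw [hb, hZ, Real.exp_le_exp, Finset.sum_sub_distrib]
    have e₁ : ∑ k ∈ range n, s * w k ω * (X k ω - (μ[X k | F k]) ω)
        = s * ∑ k ∈ range n, w k ω * (X k ω - (μ[X k | F k]) ω) := by
      rw [Finset.mul_sum]; exact Finset.sum_congr rfl fun k _ => by ring
    have e₂ : ∑ k ∈ range n, (s * w k ω) ^ 2 / 2 = s ^ 2 / 2 * ∑ k ∈ range n, w k ω ^ 2 := by
      rw [Finset.mul_sum]; exact Finset.sum_congr rfl fun k _ => by ring
    rw [e₁, e₂]
    have h₁ := mul_le_mul_of_nonneg_left hω hs0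
    have h₂ := mul_le_mul_of_nonneg_left (hwV ω) (show 0 ≤ s ^ 2 / 2 by positivity)
    have h₃ : s * c - s ^ 2 / 2 * V = c ^ 2 / (2 * V) := by rw [hs]; field_simp; ring
    linarith
  have hmk := mul_meas_ge_le_integral_of_nonneg (.of_forall fun ω => (Real.exp_pos _).le) hint b
  have hreal : μ.real {ω | b ≤ Z ω} ≤ b⁻¹ := by
    rw [← one_div, le_div_iff₀' hb0]
    exact hmk.trans hle
  refine (measure_mono hsub).trans ?_
  rw [Real.exp_neg, ← hb, ← ofReal_measureReal]
  exact ENNReal.ofReal_le_ofReal hreal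

end Concentration

section ProductStrategies

lemma one_sub_sum_le_prod {ι : Type*} (s : Finset ι) {z : ι → ℝ} (h₀ : ∀ i ∈ s, 0 ≤ z i)
    (h₁ : ∀ i ∈ s, z i ≤ 1) : 1 - ∑ i ∈ s, (1 - z i) ≤ ∏ i ∈ s, z i := by
  classical
  induction s using Finset.induction_on with
  | empty => simp
  | insert i s hi ih =>
    rw [Finset.sum_insert hi, Finset.prod_insert hi]
    have hi' := ih (fun j hj => h₀ j (mem_insert_of_mem hj)) fun j hj => h₁ j (mem_insert_of_mem hj)
    have hz₀ := h₀ i (mem_insert_self i s)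
    have hz₁ := h₁ i (mem_insert_self i s)
    have hS : 0 ≤ ∑ j ∈ s, (1 - z j) :=
      Finset.sum_nonneg fun j hj => sub_nonneg.2 (h₁ j (mem_insert_of_mem hj))
    nlinarith [mul_le_mul_of_nonneg_left hi' hz₀]

variable {N : ℕ} {A : Fin N → Type u}

lemma explorationLaw_eq [∀ i, DecidableEq (A i)] (x : ∀ j, A j → ℝ) (p : Σ i, A i)
    (b : ∀ j, A j) : explorationLaw x p b
      = if b p.1 = p.2 then ∏ j ∈ Finset.univ.erase p.1, x j (b j) else 0 := by
  unfold explorationLaw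
  congr

variable [∀ i, Fintype (A i)]

/-- The expectation of `f` when the players draw their actions independently from `x`. -/
def expect (x : ∀ j, A j → ℝ) (f : (∀ j, A j) → ℝ) : ℝ := ∑ b, (∏ j, x j (b j)) * f b

/-- The expected value of `f` when player `p.1` plays `p.2` and the others draw from `x`. -/
def deviationValue (x : ∀ j, A j → ℝ) (p : Σ i, A i) (f : (∀ j, A j) → ℝ) : ℝ :=
  ∑ b, explorationLaw x p b * f b

lemma sum_prod_eq_one {x : ∀ j, A j → ℝ} (hx : ∀ j, x j ∈ stdSimplex ℝ (A j)) :
    ∑ b : ∀ j, A j, ∏ j, x j (b j) = 1 := by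
  classical
  rw [← Fintype.prod_sum]
  exact Finset.prod_eq_one fun j _ => (hx j).2

lemma prod_strategy_nonneg {x : ∀ j, A j → ℝ} (hx : ∀ j, x j ∈ stdSimplex ℝ (A j))
    (b : ∀ j, A j) : 0 ≤ ∏ j, x j (b j) := Finset.prod_nonneg fun j _ => (hx j).1 _

lemma expect_one_sub {x : ∀ j, A j → ℝ} (hx : ∀ j, x j ∈ stdSimplex ℝ (A j))
    (f : (∀ j, A j) → ℝ) : expect x (fun b => 1 - f b) = 1 - expect x f := by
  simp only [expect, mul_sub, mul_one, Finset.sum_sub_distrib, sum_prod_eq_one hx]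

/-- If every player `j` lands in `K j` with probability at least `1 - q`, then a nonnegative
function that is at least `c` on the product of the sets `K j` has expectation at least
`c * (1 - N q)`. -/
lemma le_expect_of_le_on {x : ∀ j, A j → ℝ} (hx : ∀ j, x j ∈ stdSimplex ℝ (A j))
    (K : ∀ j, A j → Prop) [∀ j, DecidablePred (K j)] {q c : ℝ} (hc : 0 ≤ c)
    (hK : ∀ j, 1 - q ≤ ∑ a with K j a, x j a) {f : (∀ j, A j) → ℝ} (hf : ∀ b, 0 ≤ f b)
    (hfc : ∀ b, (∀ j, K j (b j)) → c ≤ f b) : c * (1 - N * q) ≤ expect x f := by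
  classical
  have hz : ∀ j, ∑ a with K j a, x j a ≤ 1 := fun j => by
    rw [← (hx j).2]
    exact Finset.sum_le_sum_of_subset_of_nonneg (Finset.filter_subset _ _) fun a _ _ => (hx j).1 a
  calc c * (1 - N * q) ≤ c * ∏ j, ∑ a with K j a, x j a := by
        gcongr
        refine le_trans ?_ (one_sub_sum_le_prod univ
          (fun j _ => Finset.sum_nonneg fun a _ => (hx j).1 a) fun j _ => hz j)
        have : ∑ j : Fin N, (1 - ∑ a with K j a, x j a) ≤ ∑ j : Fin N, q :=
          Finset.sum_le_sum fun j _ => by linarith [hK j]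
        simp only [sum_const, card_univ, Fintype.card_fin, nsmul_eq_mul] at this
        linarith
    _ = ∑ b : ∀ j, A j, (∏ j, if K j (b j) then x j (b j) else 0) * c := by
        simp_rw [Finset.sum_filter]
        rw [Fintype.prod_sum, mul_comm, Finset.sum_mul]
    _ ≤ expect x f := by
        refine Finset.sum_le_sum fun b _ => ?_
        by_cases h : ∀ j, K j (b j)
        · simp only [h, if_true]
          exact mul_le_mul_of_nonneg_left (hfc b h) (prod_strategy_nonneg hx b)
        · push Not at h
          obtain ⟨j, hj⟩ := h
          rw [Finset.prod_eq_zero (mem_univ j) (by simp [hj]), zero_mul]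
          exact mul_nonneg (prod_strategy_nonneg hx b) (hf b)

lemma sum_eq_sum_update [∀ i, DecidableEq (A i)] (i : Fin N) (a : A i) (H : (∀ j, A j) → ℝ) :
    ∑ b, H b = ∑ b, if b i = a then ∑ c, H (Function.update b i c) else 0 := by
  rw [← Finset.sum_filter, ← Finset.sum_product']
  refine Finset.sum_bij' (fun b _ => (Function.update b i a, b i))
    (fun bc _ => Function.update bc.1 i bc.2) ?_ ?_ ?_ ?_ ?_
  · intro b _; simp
  · intro b _; simp
  · intro b _; simp
  · rintro ⟨b, c⟩ h
    simp only [mem_product, mem_filter, mem_univ, true_and, and_true] at h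
    subst h
    simp
  · intro b _; simp

lemma deviationValue_eq_expect {x : ∀ j, A j → ℝ} {p : Σ i, A i}
    (hx : x p.1 ∈ stdSimplex ℝ (A p.1)) (f : (∀ j, A j) → ℝ) :
    deviationValue x p f = expect x fun b => f (Function.update b p.1 p.2) := by
  classical
  unfold deviationValue expect
  rw [sum_eq_sum_update p.1 p.2 (fun b => (∏ j, x j (b j)) * f (Function.update b p.1 p.2))]
  refine Finset.sum_congr rfl fun b _ => ?_
  rw [explorationLaw_eq]
  split_ifs with h
  · have : ∀ c, ∏ j, x j (Function.update b p.1 c j)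
        = x p.1 c * ∏ j ∈ univ.erase p.1, x j (b j) := fun c => by
      rw [← Finset.mul_prod_erase univ _ (mem_univ p.1)]
      congr 1
      · simp
      · refine Finset.prod_congr rfl fun j hj => ?_
        rw [Function.update_of_ne (Finset.ne_of_mem_erase hj)]
    have h₂ : Function.update b p.1 p.2 = b := by rw [← h]; simp
    simp only [this, Function.update_idem, h₂]
    rw [← Finset.sum_mul, ← Finset.sum_mul, hx.2, one_mul]
  · simp

lemma sum_mul_deviationValue (x : ∀ j, A j → ℝ) (i : Fin N) (f : (∀ j, A j) → ℝ) :
    ∑ a, x i a * deviationValue x ⟨i, a⟩ f = expect x f := by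
  classical
  unfold deviationValue expect
  simp_rw [Finset.mul_sum]
  rw [Finset.sum_comm]
  refine Finset.sum_congr rfl fun b _ => ?_
  rw [Finset.sum_eq_single (b i)]
  · rw [explorationLaw_eq, if_pos rfl, ← mul_assoc,
      Finset.mul_prod_erase univ (fun j => x j (b j)) (mem_univ i)]
  · intro a _ h
    rw [explorationLaw_eq, if_neg (fun h' => h h'.symm)]
    simp
  · simp

lemma pointMass_mem_stdSimplex {B : Type u} [Fintype B] (a : B) :
    pointMass a ∈ stdSimplex ℝ B := by
  classical
  refine ⟨fun b => ?_, ?_⟩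
  · unfold pointMass; split_ifs <;> simp
  · simp [pointMass]

lemma deviationValue_pointMass (c : ∀ j, A j) (p : Σ i, A i) (f : (∀ j, A j) → ℝ) :
    deviationValue (fun j => pointMass (c j)) p f = f (Function.update c p.1 p.2) := by
  rw [deviationValue_eq_expect (pointMass_mem_stdSimplex _)]
  unfold expect
  rw [Finset.sum_eq_single c]
  · simp [pointMass]
  · intro b _ hb
    obtain ⟨j, hj⟩ := Function.ne_iff.1 hb
    rw [Finset.prod_eq_zero (mem_univ j) (by simp [pointMass, hj]), zero_mul]
  · simp

end ProductStrategies

section Clipping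

variable {B : Type u} [Fintype B]

lemma one_sub_card_mul_le_sum_filter {x : B → ℝ} (hx : x ∈ stdSimplex ℝ B) {K : B → Prop}
    [DecidablePred K] {p : ℝ} (hp : 0 ≤ p) (hK : ∀ a, ¬ K a → x a ≤ p) {m : ℕ}
    (hm : Fintype.card B ≤ m) : 1 - m * p ≤ ∑ a with K a, x a := by
  have h := Finset.sum_filter_add_sum_filter_not univ K x
  rw [hx.2] at h
  have h₂ : ∑ a with ¬ K a, x a ≤ ∑ a : B with ¬ K a, p :=
    Finset.sum_le_sum fun a ha => hK a (mem_filter.1 ha).2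
  have h₃ : ((univ.filter fun a : B => ¬ K a).card : ℝ) ≤ m := by
    exact_mod_cast (Finset.card_filter_le _ _).trans hm
  rw [Finset.sum_const, nsmul_eq_mul] at h₂
  nlinarith [mul_le_mul_of_nonneg_right h₃ hp]

variable {x : B → ℝ} {p : ℝ}

lemma sum_filter_le_one (hx : x ∈ stdSimplex ℝ B) (K : B → Prop) [DecidablePred K] :
    ∑ a with K a, x a ≤ 1 := by
  rw [← hx.2]
  exact Finset.sum_le_sum_of_subset_of_nonneg (Finset.filter_subset _ _) fun a _ _ => hx.1 a

lemma clip_mem_stdSimplex (hx : x ∈ stdSimplex ℝ B) (hZ : 0 < ∑ b with p ≤ x b, x b) :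
    clip p x ∈ stdSimplex ℝ B := by
  refine ⟨fun a => ?_, ?_⟩
  · unfold clip
    split_ifs
    exacts [le_rfl, div_nonneg (hx.1 a) hZ.le]
  · have : ∀ a, clip p x a = (if p ≤ x a then x a else 0) / ∑ b with p ≤ x b, x b := fun a => by
      unfold clip
      by_cases h : p ≤ x a
      · simp [h, not_lt.2 h]
      · simp [h, not_le.1 h]
    simp_rw [this]
    rw [← Finset.sum_div, ← Finset.sum_filter, div_self hZ.ne']

lemma filter_le_clip (hx : x ∈ stdSimplex ℝ B) (hZ : 0 < ∑ b with p ≤ x b, x b) (a : B) :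
    (if p ≤ x a then x a else 0) ≤ clip p x a := by
  unfold clip
  by_cases h : p ≤ x a
  · simp only [h, if_true, not_lt.2 h, if_false]
    exact le_div_self (hx.1 a) hZ (sum_filter_le_one hx _)
  · simp [h, not_le.1 h]

lemma le_of_clip_ne_zero {a : B} (h : clip p x a ≠ 0) : p ≤ x a := by
  by_contra h'
  exact h (by simp [clip, not_le.1 h'])

variable {N : ℕ} {A : Fin N → Type u} [∀ i, Fintype (A i)] {m : ℕ}

lemma expect_sub_le_expect_clip {x : ∀ j, A j → ℝ} (hx : ∀ j, x j ∈ stdSimplex ℝ (A j))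
    (hp : 0 ≤ p) (hm : ∀ j, Fintype.card (A j) ≤ m) (hmp : m * p < 1) {f : (∀ j, A j) → ℝ}
    (hf : ∀ b, f b ∈ Set.Icc (0 : ℝ) 1) :
    expect x f - N * (m * p) ≤ expect (fun j => clip p (x j)) f := by
  classical
  have hZ : ∀ j, 1 - m * p ≤ ∑ a with p ≤ x j a, x j a := fun j =>
    one_sub_card_mul_le_sum_filter (hx j) hp (fun a h => (not_le.1 h).le) (hm j)
  have hZ0 : ∀ j, 0 < ∑ a with p ≤ x j a, x j a := fun j => by linarith [hZ j]
  have hprod : 1 - N * (m * p) ≤ ∑ b : ∀ j, A j, ∏ j, if p ≤ x j (b j) then x j (b j) else 0 := by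
    rw [← Fintype.prod_sum (fun j a => if p ≤ x j a then x j a else 0)]
    simp_rw [← Finset.sum_filter]
    refine le_trans ?_ (one_sub_sum_le_prod univ (fun j _ => (hZ0 j).le)
      fun j _ => sum_filter_le_one (hx j) _)
    have : ∑ j : Fin N, (1 - ∑ a with p ≤ x j a, x j a) ≤ ∑ j : Fin N, m * p :=
      Finset.sum_le_sum fun j _ => by linarith [hZ j]
    simp only [sum_const, card_univ, Fintype.card_fin, nsmul_eq_mul] at this
    linarith
  have hle : ∀ b : ∀ j, A j, (∏ j, if p ≤ x j (b j) then x j (b j) else 0) ≤ ∏ j, x j (b j) :=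
    fun b => Finset.prod_le_prod (fun j _ => by split_ifs; exacts [(hx j).1 _, le_rfl])
      fun j _ => by split_ifs; exacts [le_rfl, (hx j).1 _]
  have hle' : ∀ b : ∀ j, A j,
      (∏ j, if p ≤ x j (b j) then x j (b j) else 0) ≤ ∏ j, clip p (x j) (b j) :=
    fun b => Finset.prod_le_prod (fun j _ => by split_ifs; exacts [(hx j).1 _, le_rfl])
      fun j _ => filter_le_clip (hx j) (hZ0 j) _
  have h₁ : ∑ b : ∀ j, A j, (∏ j, if p ≤ x j (b j) then x j (b j) else 0) * f b
      ≤ expect (fun j => clip p (x j)) f :=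
    Finset.sum_le_sum fun b _ => mul_le_mul_of_nonneg_right (hle' b) (hf b).1
  have h₂ : expect x f - ∑ b : ∀ j, A j, (∏ j, if p ≤ x j (b j) then x j (b j) else 0) * f b
      ≤ ∑ b : ∀ j, A j, ∏ j, x j (b j)
        - ∑ b : ∀ j, A j, ∏ j, if p ≤ x j (b j) then x j (b j) else 0 := by
    unfold expect
    rw [← Finset.sum_sub_distrib, ← Finset.sum_sub_distrib]
    refine Finset.sum_le_sum fun b _ => ?_
    rw [← sub_mul]
    exact mul_le_of_le_one_right (sub_nonneg.2 (hle b)) (hf b).2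
  rw [sum_prod_eq_one hx] at h₂
  linarith

lemma abs_expect_clip_sub_le {x : ∀ j, A j → ℝ} (hx : ∀ j, x j ∈ stdSimplex ℝ (A j))
    (hp : 0 ≤ p) (hm : ∀ j, Fintype.card (A j) ≤ m) (hmp : m * p < 1) {f : (∀ j, A j) → ℝ}
    (hf : ∀ b, f b ∈ Set.Icc (0 : ℝ) 1) :
    |expect (fun j => clip p (x j)) f - expect x f| ≤ N * (m * p) := by
  have h₁ := expect_sub_le_expect_clip hx hp hm hmp hf
  have h₂ := expect_sub_le_expect_clip hx hp hm hmp (f := fun b => 1 - f b)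
    fun b => ⟨by linarith [(hf b).2], by linarith [(hf b).1]⟩
  have hZ : ∀ j, 0 < ∑ a with p ≤ x j a, x j a := fun j => by
    linarith [one_sub_card_mul_le_sum_filter (hx j) hp (K := fun a => p ≤ x j a)
      (fun a h => (not_le.1 h).le) (hm j)]
  rw [expect_one_sub hx, expect_one_sub fun j => clip_mem_stdSimplex (hx j) (hZ j)] at h₂
  rw [abs_le]
  constructor <;> linarith

end Clipping

section Softmax

variable {B : Type u} [Fintype B]

/-- The strategy proportional to `exp (η * S)`. -/
def softmax (η : ℝ) (S : B → ℝ) (a : B) : ℝ := Real.exp (η * S a) / ∑ b, Real.exp (η * S b)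

/-- The scaled logarithm of the mean of `exp (η * S)`. -/
def logPotential (η : ℝ) (S : B → ℝ) : ℝ :=
  Real.log (∑ a, (Fintype.card B : ℝ)⁻¹ * Real.exp (η * S a)) / η

variable [Nonempty B]

lemma sum_exp_pos (S : B → ℝ) : 0 < ∑ b, Real.exp (S b) :=
  Finset.sum_pos (fun _ _ => Real.exp_pos _) univ_nonempty

lemma sum_card_inv_mul_exp_pos (S : B → ℝ) :
    0 < ∑ a, (Fintype.card B : ℝ)⁻¹ * Real.exp (S a) := by
  rw [← Finset.mul_sum]
  exact mul_pos (by positivity) (sum_exp_pos S)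

lemma softmax_mem_stdSimplex (η : ℝ) (S : B → ℝ) : softmax η S ∈ stdSimplex ℝ B := by
  have h := sum_exp_pos fun b => η * S b
  refine ⟨fun a => div_nonneg (Real.exp_pos _).le h.le, ?_⟩
  unfold softmax
  rw [← Finset.sum_div, div_self h.ne']

lemma softmax_le (η : ℝ) (S : B → ℝ) (a a' : B) :
    softmax η S a ≤ Real.exp (-(η * (S a' - S a))) := by
  unfold softmax
  rw [div_le_iff₀ (sum_exp_pos fun b => η * S b)]
  calc Real.exp (η * S a) = Real.exp (-(η * (S a' - S a))) * Real.exp (η * S a') := by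
        rw [← Real.exp_add]; ring_nf
    _ ≤ _ := by
        gcongr
        exact Finset.single_le_sum (f := fun b => Real.exp (η * S b))
          (fun b _ => (Real.exp_pos _).le) (mem_univ a')

lemma logPotential_mono {η η' : ℝ} (h₀ : 0 < η') (h : η' ≤ η) (S : B → ℝ) :
    logPotential η' S ≤ logPotential η S := by
  have hη : 0 < η := h₀.trans_le h
  unfold logPotential
  have hJ := Real.rpow_arith_mean_le_arith_mean_rpow univ (fun _ : B => (Fintype.card B : ℝ)⁻¹)
    (fun a => Real.exp (η' * S a)) (fun _ _ => by positivity) (by simp)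
    (fun _ _ => (Real.exp_pos _).le) (p := η / η') ((one_le_div h₀).2 h)
  have he : ∀ a, Real.exp (η' * S a) ^ (η / η') = Real.exp (η * S a) := fun a => by
    rw [← Real.exp_mul]; congr 1; field_simp
  simp_rw [he] at hJ
  have hpos := sum_card_inv_mul_exp_pos fun a => η' * S a
  have hl := Real.log_le_log (Real.rpow_pos_of_pos hpos _) hJ
  rw [Real.log_rpow hpos] at hl
  rw [le_div_iff₀ hη]
  calc _ = η / η' * Real.log (∑ a, (Fintype.card B : ℝ)⁻¹ * Real.exp (η' * S a)) := by ring
    _ ≤ _ := hl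

lemma logPotential_le_one {η : ℝ} (hη : 0 < η) {S : B → ℝ} (hS : ∀ a, S a ≤ 1) :
    logPotential η S ≤ 1 := by
  unfold logPotential
  rw [div_le_one hη, Real.log_le_iff_le_exp (sum_card_inv_mul_exp_pos _)]
  calc _ ≤ ∑ a : B, (Fintype.card B : ℝ)⁻¹ * Real.exp η := by
        gcongr with a
        nlinarith [hS a]
    _ = Real.exp η := by simp

lemma le_logPotential {η : ℝ} (hη : 0 < η) (S : B → ℝ) (a : B) :
    S a - Real.log (Fintype.card B) / η ≤ logPotential η S := by
  unfold logPotential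
  rw [le_div_iff₀ hη, sub_mul, div_mul_cancel₀ _ hη.ne', mul_comm, ← Finset.mul_sum,
    Real.log_mul (by positivity) (sum_exp_pos _).ne', Real.log_inv]
  have : η * S a ≤ Real.log (∑ b, Real.exp (η * S b)) := by
    rw [Real.le_log_iff_exp_le (sum_exp_pos _)]
    exact Finset.single_le_sum (f := fun b => Real.exp (η * S b))
      (fun b _ => (Real.exp_pos _).le) (mem_univ a)
  linarith

lemma logPotential_add_le {η : ℝ} (hη : 0 < η) (S : B → ℝ) {v : B → ℝ}
    (hv : ∀ a, v a ∈ Set.Icc (0 : ℝ) 1) :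
    logPotential η (fun a => S a + v a)
      ≤ logPotential η S + (∑ a, softmax η S a * v a + η / 2) := by
  set θ := softmax η S with hθ
  have hθs : θ ∈ stdSimplex ℝ B := softmax_mem_stdSimplex η S
  set c := ∑ a, θ a * v a with hc
  have hc₀ : 0 ≤ c := Finset.sum_nonneg fun a _ => mul_nonneg (hθs.1 a) (hv a).1
  have hc₁ : c ≤ 1 := by
    rw [← hθs.2]
    exact Finset.sum_le_sum fun a _ => mul_le_of_le_one_right (hθs.1 a) (hv a).2
  have hmgf : ∑ a, θ a * Real.exp (η * v a) ≤ Real.exp (η * c + η ^ 2 / 2) := by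
    calc ∑ a, θ a * Real.exp (η * v a)
        ≤ ∑ a, θ a * (Real.exp (η * c) * (Real.cosh η + (v a - c) * Real.sinh η)) := by
          refine Finset.sum_le_sum fun a _ => mul_le_mul_of_nonneg_left ?_ (hθs.1 a)
          rw [show η * v a = η * c + η * (v a - c) by ring, Real.exp_add]
          gcongr
          exact exp_mul_le_cosh_add_mul_sinh η (by linarith [(hv a).1]) (by linarith [(hv a).2])
      _ = Real.exp (η * c) * (Real.cosh η * ∑ a, θ a
            + Real.sinh η * (∑ a, θ a * v a - c * ∑ a, θ a)) := by
          simp_rw [Finset.mul_sum, ← Finset.sum_sub_distrib, Finset.mul_sum,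
            ← Finset.sum_add_distrib, Finset.mul_sum]
          exact Finset.sum_congr rfl fun a _ => by ring
      _ = Real.exp (η * c) * Real.cosh η := by rw [hθs.2, ← hc]; ring
      _ ≤ _ := by rw [Real.exp_add]; gcongr; exact Real.cosh_le_exp_half_sq η
  have hfac : ∑ a, (Fintype.card B : ℝ)⁻¹ * Real.exp (η * (S a + v a))
      = (∑ a, (Fintype.card B : ℝ)⁻¹ * Real.exp (η * S a)) * ∑ a, θ a * Real.exp (η * v a) := by
    have h := sum_exp_pos fun b => η * S b
    have h' : ∀ a, Real.exp (η * (S a + v a))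
        = (∑ b, Real.exp (η * S b)) * (θ a * Real.exp (η * v a)) := fun a => by
      rw [hθ, softmax, mul_add, Real.exp_add]
      field_simp
    simp_rw [h', ← Finset.mul_sum]
    ring
  have hpos : 0 < ∑ a, θ a * Real.exp (η * v a) := by
    have h₁ := sum_card_inv_mul_exp_pos fun a => η * (S a + v a)
    rw [hfac] at h₁
    exact (mul_pos_iff_of_pos_left (sum_card_inv_mul_exp_pos fun a => η * S a)).1 h₁
  unfold logPotential
  rw [hfac, Real.log_mul (sum_card_inv_mul_exp_pos _).ne' hpos.ne', add_div]
  gcongr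
  rw [div_le_iff₀ hη, Real.log_le_iff_le_exp hpos]
  convert hmgf using 2
  ring

/-- The regret bound of Hedge with nonincreasing learning rates, for an arbitrary first round. -/
theorem hedge_regret_le {η : ℕ → ℝ} (hη : ∀ t, 1 ≤ t → 0 < η t)
    (hanti : ∀ t, 1 ≤ t → η (t + 1) ≤ η t) {v θ : ℕ → B → ℝ}
    (hv : ∀ t a, v t a ∈ Set.Icc (0 : ℝ) 1)
    (hθ : ∀ t, 1 ≤ t → θ t = softmax (η t) fun a => ∑ τ ∈ range t, v τ a)
    {T : ℕ} (hT : 1 ≤ T) (a : B) :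
    ∑ τ ∈ range T, v τ a ≤ 1 + Real.log (Fintype.card B) / η T
      + ∑ t ∈ Ico 1 T, (∑ b, θ t b * v t b + η t / 2) := by
  have key : ∀ n, 1 ≤ n → logPotential (η n) (fun a => ∑ τ ∈ range n, v τ a)
      ≤ 1 + ∑ t ∈ Ico 1 n, (∑ b, θ t b * v t b + η t / 2) := by
    intro n hn
    induction n, hn using Nat.le_induction with
    | base =>
      simp only [range_one, sum_singleton, Ico_self, sum_empty, add_zero]
      exact logPotential_le_one (hη 1 le_rfl) fun a => (hv 0 a).2
    | succ n hn ih =>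
      rw [Finset.sum_Ico_succ_top hn]
      refine (logPotential_mono (hη _ (by omega)) (hanti n hn) _).trans ?_
      simp_rw [Finset.sum_range_succ]
      refine (logPotential_add_le (hη n hn) _ (hv n)).trans ?_
      rw [← hθ n hn]
      linarith
  have h₁ := key T hT
  have h₂ := le_logPotential (hη T hT) (fun a => ∑ τ ∈ range T, v τ a) a
  linarith

end Softmax

section LearningRate

lemma sum_one_div_sqrt_le (n : ℕ) : ∑ t ∈ range n, 1 / √((t : ℝ) + 1) ≤ 2 * √n := by
  induction n with
  | zero => simp
  | succ n ih =>
    rw [Finset.sum_range_succ]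
    push_cast
    have hb : 0 < √((n : ℝ) + 1) := Real.sqrt_pos.2 (by positivity)
    have ha : 0 ≤ √(n : ℝ) := Real.sqrt_nonneg _
    have hb2 := Real.sq_sqrt (show (0 : ℝ) ≤ (n : ℝ) + 1 by positivity)
    have ha2 := Real.sq_sqrt (show (0 : ℝ) ≤ (n : ℝ) by positivity)
    have : 1 / √((n : ℝ) + 1) ≤ 2 * (√((n : ℝ) + 1) - √n) := by
      rw [div_le_iff₀ hb]
      nlinarith [sq_nonneg (√((n : ℝ) + 1) - √n)]
    linarith

lemma sum_one_div_le (n : ℕ) : ∑ t ∈ range n, 1 / ((t : ℝ) + 1) ≤ 1 + Real.log n := by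
  have h := harmonic_le_one_add_log n
  simpa [harmonic] using h

variable {n m : ℕ} {ε Δ : ℝ}

lemma clipThreshold_pos (hn : 1 ≤ n) (hm : 1 ≤ m) (hε : 0 < ε) (hΔ : 0 < Δ) :
    0 < clipThreshold n m ε Δ := by
  unfold clipThreshold
  have : 0 < min ε Δ := lt_min hε hΔ
  have : (0 : ℝ) < n := by exact_mod_cast hn
  have : (0 : ℝ) < m := by exact_mod_cast hm
  positivity

lemma mul_clipThreshold (hn : 1 ≤ n) (hm : 1 ≤ m) :
    n * (m * clipThreshold n m ε Δ) = min ε Δ / 8 := by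
  unfold clipThreshold
  have : (0 : ℝ) < n := by exact_mod_cast hn
  have : (0 : ℝ) < m := by exact_mod_cast hm
  field_simp

lemma mul_clipThreshold_le (hn : 1 ≤ n) (hm : 1 ≤ m) (hε : 0 < ε) (hΔ : 0 < Δ) (hε1 : ε ≤ 1) :
    m * clipThreshold n m ε Δ ≤ 1 / 8 := by
  have h := mul_clipThreshold (ε := ε) (Δ := Δ) hn hm
  have h₁ : (1 : ℝ) ≤ n := by exact_mod_cast hn
  have h₂ : 0 ≤ m * clipThreshold n m ε Δ :=
    mul_nonneg (Nat.cast_nonneg _) (clipThreshold_pos hn hm hε hΔ).le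
  nlinarith [min_le_left ε Δ]

lemma clipThreshold_le (hn : 1 ≤ n) (hm : 1 ≤ m) (hε : 0 < ε) (hΔ : 0 < Δ) (hε1 : ε ≤ 1) :
    clipThreshold n m ε Δ ≤ 1 / 8 := by
  have h := mul_clipThreshold_le hn hm hε hΔ hε1
  have h₁ : (1 : ℝ) ≤ m := by exact_mod_cast hm
  nlinarith [clipThreshold_pos hn hm hε hΔ]

lemma log_one_div_clipThreshold_pos (hn : 1 ≤ n) (hm : 1 ≤ m) (hε : 0 < ε) (hΔ : 0 < Δ)
    (hε1 : ε ≤ 1) : 0 < Real.log (1 / clipThreshold n m ε Δ) := by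
  refine Real.log_pos ?_
  rw [lt_div_iff₀ (clipThreshold_pos hn hm hε hΔ)]
  linarith [clipThreshold_le hn hm hε hΔ hε1]

lemma learningRate_pos (hn : 1 ≤ n) (hm : 1 ≤ m) (hε : 0 < ε) (hΔ : 0 < Δ) (hε1 : ε ≤ 1)
    {t : ℕ} (ht : 1 ≤ t) : 0 < learningRate n m ε Δ t := by
  refine lt_max_of_lt_right ?_
  have := log_one_div_clipThreshold_pos hn hm hε hΔ hε1
  have : (0 : ℝ) < t := by exact_mod_cast ht
  positivity

lemma learningRate_succ_le (hn : 1 ≤ n) (hm : 1 ≤ m) (hε : 0 < ε) (hΔ : 0 < Δ) (hε1 : ε ≤ 1)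
    {t : ℕ} (ht : 1 ≤ t) : learningRate n m ε Δ (t + 1) ≤ learningRate n m ε Δ t := by
  have h₁ := log_one_div_clipThreshold_pos hn hm hε hΔ hε1
  have h₂ : (0 : ℝ) < t := by exact_mod_cast ht
  have h₃ : 0 ≤ Real.log m := Real.log_natCast_nonneg m
  unfold learningRate
  push_cast
  gcongr <;> linarith

lemma log_div_learningRate_le (hn : 1 ≤ n) (hm : 1 ≤ m) (hε : 0 < ε) (hΔ : 0 < Δ) (hε1 : ε ≤ 1)
    {t : ℕ} (ht : 1 ≤ t) : Real.log m / learningRate n m ε Δ t ≤ √(t * Real.log m) := by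
  have hp := learningRate_pos hn hm hε hΔ hε1 ht
  have h₂ : (0 : ℝ) < t := by exact_mod_cast ht
  have h₃ : 0 ≤ Real.log m := Real.log_natCast_nonneg m
  rw [div_le_iff₀ hp]
  calc Real.log m = √(t * Real.log m) * √(Real.log m / t) := by
        rw [← Real.sqrt_mul (by positivity), show t * Real.log m * (Real.log m / t)
          = Real.log m ^ 2 by field_simp, Real.sqrt_sq h₃]
    _ ≤ _ := by gcongr; exact le_max_left _ _

lemma sum_learningRate_le (hn : 1 ≤ n) (hm : 1 ≤ m) (hε : 0 < ε) (hΔ : 0 < Δ) (hε1 : ε ≤ 1)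
    (T : ℕ) : ∑ t ∈ Ico 1 T, learningRate n m ε Δ t
      ≤ 2 * √(T * Real.log m)
        + 4 * Real.log (1 / clipThreshold n m ε Δ) / Δ * (1 + Real.log T) := by
  have h₁ := log_one_div_clipThreshold_pos hn hm hε hΔ hε1
  have h₃ : 0 ≤ Real.log m := Real.log_natCast_nonneg m
  have hle : ∑ t ∈ Ico 1 T, learningRate n m ε Δ t
      ≤ ∑ t ∈ range T, learningRate n m ε Δ (t + 1) := by
    rw [Finset.sum_Ico_eq_sum_range]
    simp_rw [add_comm 1]
    refine Finset.sum_le_sum_of_subset_of_nonneg (range_subset_range.2 (by omega)) ?_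
    intro t _ _
    exact (learningRate_pos hn hm hε hΔ hε1 (by omega)).le
  refine hle.trans ?_
  calc _ ≤ ∑ t ∈ range T, (√(Real.log m) * (1 / √((t : ℝ) + 1))
        + 4 * Real.log (1 / clipThreshold n m ε Δ) / Δ * (1 / ((t : ℝ) + 1))) := by
        refine Finset.sum_le_sum fun t _ => ?_
        unfold learningRate
        push_cast
        refine (max_le_add_of_nonneg (Real.sqrt_nonneg _) (by positivity)).trans (le_of_eq ?_)
        rw [Real.sqrt_div h₃]
        field_simp
    _ ≤ √(Real.log m) * (2 * √T)
        + 4 * Real.log (1 / clipThreshold n m ε Δ) / Δ * (1 + Real.log T) := by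
        rw [Finset.sum_add_distrib, ← Finset.mul_sum, ← Finset.mul_sum]
        gcongr
        · exact sum_one_div_sqrt_le T
        · exact sum_one_div_le T
    _ = _ := by rw [Real.sqrt_mul (Nat.cast_nonneg T)]; ring

end LearningRate

section Elimination

variable {N : ℕ} {A : Fin N → Type u} [∀ i, Fintype (A i)] (G : Game A) (Δ : ℝ)

lemma elim_subset_succ (l : ℕ) : elim G Δ l ⊆ elim G Δ (l + 1) := by
  induction l with
  | zero => exact Set.empty_subset _
  | succ l ih =>
    rintro p ⟨x, hx, h⟩
    exact ⟨x, hx, fun b hb => h b fun j hj hmem => hb j hj (ih hmem)⟩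

lemma elimLength_spec :
    1 ≤ elimLength G Δ ∧ elim G Δ (elimLength G Δ + 1) = elim G Δ (elimLength G Δ) := by
  have hne : {l | 1 ≤ l ∧ elim G Δ (l + 1) = elim G Δ l}.Nonempty := by
    obtain ⟨n, hn⟩ := WellFoundedGT.monotone_chain_condition
      (⟨elim G Δ, monotone_nat_of_le_succ (elim_subset_succ G Δ)⟩ : ℕ →o Set (Σ i, A i))
    have h₁ := hn (n + 1) (by omega)
    have h₂ := hn (n + 2) (by omega)
    exact ⟨n + 1, by omega, h₂.symm.trans h₁⟩
  exact Nat.sInf_mem hne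

variable {G Δ}

lemma card_le_maxActions (j : Fin N) : Fintype.card (A j) ≤ maxActions A :=
  Finset.le_sup (f := fun i => Fintype.card (A i)) (mem_univ j)

lemma one_le_maxActions [∀ i, Nonempty (A i)] (hN : 1 ≤ N) : 1 ≤ maxActions A :=
  (Fintype.card_pos (α := A ⟨0, hN⟩)).trans_le (card_le_maxActions _)

/-- An eliminated action is dominated, up to the probability that an opponent plays an eliminated
action, against every product strategy. -/
lemma exists_dominating (hΔ : 0 < Δ) (hΔ1 : Δ ≤ 1) {p : Σ i, A i}
    (hp : p ∈ elim G Δ (elimLength G Δ)) {q : ℝ} (hq : 0 ≤ q)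
    (hNq : N * (maxActions A * q) ≤ Δ / 8) :
    ∃ y ∈ stdSimplex ℝ (A p.1), ∀ x : ∀ j, A j → ℝ, (∀ j, x j ∈ stdSimplex ℝ (A j)) →
      (∀ c : Σ i, A i, c ∈ elim G Δ (elimLength G Δ) → x c.1 c.2 ≤ q) →
      deviationValue x p (G.util p.1) + 3 / 4 * Δ
        ≤ ∑ a, y a * deviationValue x ⟨p.1, a⟩ (G.util p.1) := by
  classical
  rw [← (elimLength_spec G Δ).2] at hp
  obtain ⟨y, hy, hdom⟩ := hp
  refine ⟨y, hy, fun x hx hxq => ?_⟩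
  set f : (∀ j, A j) → ℝ := fun b => 1 + ((∑ a, y a * G.util p.1 (Function.update b p.1 a))
    - G.util p.1 (Function.update b p.1 p.2)) with hf
  have key := le_expect_of_le_on hx
    (fun j c => j ≠ p.1 → (⟨j, c⟩ : Σ i, A i) ∉ elim G Δ (elimLength G Δ))
    (q := maxActions A * q) (c := 1 + Δ) (by linarith)
    (fun j => one_sub_card_mul_le_sum_filter (hx j) hq (fun a ha => by
      push Not at ha
      exact hxq ⟨j, a⟩ ha.2) (card_le_maxActions j)) (f := f)
    (fun b => by
      have h₁ := (G.util_mem p.1 (Function.update b p.1 p.2)).2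
      have h₂ : 0 ≤ ∑ a, y a * G.util p.1 (Function.update b p.1 a) :=
        Finset.sum_nonneg fun a _ => mul_nonneg (hy.1 a) (G.util_mem _ _).1
      simp only [hf]
      linarith)
    (fun b hb => by
      have := hdom b hb
      simp only [hf]
      linarith)
  have hlin : expect x f = 1 + ((∑ a, y a * deviationValue x ⟨p.1, a⟩ (G.util p.1))
      - deviationValue x p (G.util p.1)) := by
    have hdev : ∀ a, deviationValue x ⟨p.1, a⟩ (G.util p.1)
        = expect x fun b => G.util p.1 (Function.update b p.1 a) := fun a =>
      deviationValue_eq_expect (p := ⟨p.1, a⟩) (hx p.1) _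
    rw [hdev p.2]
    simp_rw [hdev]
    unfold expect
    simp only [hf, mul_add, mul_sub, mul_one, Finset.sum_add_distrib, Finset.sum_sub_distrib,
      sum_prod_eq_one hx]
    congr 2
    simp_rw [Finset.mul_sum]
    rw [Finset.sum_comm]
    exact Finset.sum_congr rfl fun a _ => Finset.sum_congr rfl fun b _ => by ring
  rw [hlin] at key
  nlinarith [mul_nonneg (Nat.cast_nonneg (α := ℝ) N)
    (mul_nonneg (Nat.cast_nonneg (α := ℝ) (maxActions A)) hq)]

/-- Iterative best response with estimates of accuracy `Δ / 2` ends at rationalizable actions. -/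
lemma bestResponse_notMem_elim {prof : ℕ → ∀ j, A j} {est : Fin (elimLength G Δ) → (Σ i, A i) → ℝ}
    (hest : ∀ l p, |est l p - G.util p.1 (Function.update (prof l) p.1 p.2)| < Δ / 2)
    (hbest : ∀ l i a, est l ⟨i, a⟩ ≤ est l ⟨i, prof (l + 1) i⟩) (l : ℕ) (hl : l ≤ elimLength G Δ)
    (i : Fin N) : (⟨i, prof l i⟩ : Σ i, A i) ∉ elim G Δ l := by
  induction l generalizing i with
  | zero => exact Set.notMem_empty _
  | succ l ih =>
    rintro ⟨x, hx, h⟩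
    simp only at h hx
    have hd := h (prof l) fun j _ => ih (by omega) j
    set l' : Fin (elimLength G Δ) := ⟨l, hl⟩
    have hle : ∑ a, x a * G.util i (Function.update (prof l) i a)
        ≤ ∑ a, x a * (est l' ⟨i, prof (l + 1) i⟩ + Δ / 2) := by
      refine Finset.sum_le_sum fun a _ => mul_le_mul_of_nonneg_left ?_ (hx.1 a)
      have h₁ := abs_lt.1 (hest l' ⟨i, a⟩)
      have h₂ := hbest l' i a
      simp only [l'] at h₁ h₂ ⊢
      linarith [h₁.1]
    rw [← Finset.sum_mul, hx.2, one_mul] at hle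
    have h₃ := abs_lt.1 (hest l' ⟨i, prof (l + 1) i⟩)
    simp only [l'] at h₃ hle
    linarith [h₃.2]

end Elimination

section HedgeStrategies

variable {N : ℕ} {A : Fin N → Type u} [∀ i, Fintype (A i)] {G : Game A} {Δ δ : ℝ} {T : ℕ}

/-- The average payoff of `p` in Hedge round `t + 1`, and `0` after the last round. -/
def roundPayoff (r : Slot G Δ δ T → ℝ) (t : ℕ) (p : Σ i, A i) : ℝ :=
  if h : t < T then hedgeAverage r ⟨t, h⟩ p else 0

lemma sum_filter_hedgeAverage (r : Slot G Δ δ T → ℝ) (n : ℕ) (p : Σ i, A i) :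
    ∑ τ ∈ Finset.univ.filter (fun τ : Fin T => (τ : ℕ) < n), hedgeAverage r τ p
      = ∑ τ ∈ range n, roundPayoff r τ p := by
  have h₁ : ∀ τ : Fin T, hedgeAverage r τ p = roundPayoff r τ p := fun τ => by
    simp [roundPayoff]
  simp_rw [h₁]
  rw [Finset.sum_filter, Fin.sum_univ_eq_sum_range (fun τ => if τ < n then roundPayoff r τ p else 0)
    T, ← Finset.sum_filter]
  refine Finset.sum_subset (fun τ hτ => by simp at hτ ⊢; omega) fun τ hτ hτ' => ?_
  have : ¬ τ < T := fun h => hτ' (by simp at hτ ⊢; omega)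
  simp [roundPayoff, this]

lemma roundPayoff_mem {r : Slot G Δ δ T → ℝ} (hr : ∀ s, r s ∈ Set.Icc (0 : ℝ) 1) (t : ℕ)
    (p : Σ i, A i) : roundPayoff r t p ∈ Set.Icc (0 : ℝ) 1 := by
  unfold roundPayoff
  split_ifs with h
  · unfold hedgeAverage
    refine ⟨div_nonneg (Finset.sum_nonneg fun m _ => (hr _).1) (Nat.cast_nonneg _), ?_⟩
    refine div_le_one_of_le₀ ?_ (Nat.cast_nonneg _)
    refine (Finset.sum_le_sum fun m _ => (hr _).2).trans ?_
    simp
  · simp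

lemma hedge_zero (ε : ℝ) (astar : ∀ j, A j) (r : Slot G Δ δ T → ℝ) (i : Fin N) :
    hedge ε astar r 0 i = pointMass (astar i) := rfl

lemma hedge_succ (ε : ℝ) (astar : ∀ j, A j) (r : Slot G Δ δ T → ℝ) (t : ℕ) (i : Fin N) :
    hedge ε astar r (t + 1) i = softmax (learningRate N (maxActions A) ε Δ (t + 1))
      fun a => ∑ τ ∈ range (t + 1), roundPayoff r τ ⟨i, a⟩ := by
  funext a
  simp only [hedge, softmax, sum_filter_hedgeAverage]

lemma hedge_mem_stdSimplex [∀ i, Nonempty (A i)] (ε : ℝ) (astar : ∀ j, A j)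
    (r : Slot G Δ δ T → ℝ) (t : ℕ) (i : Fin N) :
    hedge ε astar r t i ∈ stdSimplex ℝ (A i) := by
  cases t with
  | zero => exact pointMass_mem_stdSimplex _
  | succ t => rw [hedge_succ]; exact softmax_mem_stdSimplex _ _

/-- The expected payoff of `p` against the strategies of Hedge round `t + 1`. -/
def roundValue (ε : ℝ) (astar : ∀ j, A j) (r : Slot G Δ δ T → ℝ) (t : ℕ) (p : Σ i, A i) : ℝ :=
  deviationValue (hedge ε astar r t) p (G.util p.1)

variable [∀ i, Nonempty (A i)] {ε : ℝ} {astar : ∀ j, A j} {r : Slot G Δ δ T → ℝ}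

/-- If the cumulative estimates are accurate up to `t Δ / 4`, Hedge plays every eliminated action
with probability below the clipping threshold. -/
lemma hedge_lt_clipThreshold (hN : 1 ≤ N) (hε : 0 < ε) (hε1 : ε ≤ 1) (hΔ : 0 < Δ) (hΔ1 : Δ ≤ 1)
    (hstar : ∀ i, Rationalizable G Δ i (astar i))
    (hacc : ∀ n, 1 ≤ n → n ≤ T → ∀ p,
      |∑ τ ∈ range n, (roundPayoff r τ p - roundValue ε astar r τ p)| < n * (Δ / 4))
    {t : ℕ} (ht : t ≤ T) {p : Σ i, A i} (hp : p ∈ elim G Δ (elimLength G Δ)) :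
    hedge ε astar r t p.1 p.2 < clipThreshold N (maxActions A) ε Δ := by
  have hm : 1 ≤ maxActions A := one_le_maxActions hN
  have hq := clipThreshold_pos hN hm hε hΔ
  induction t using Nat.strong_induction_on generalizing p with
  | _ t ih =>
    cases t with
    | zero =>
      rw [hedge_zero]
      have hne : p.2 ≠ astar p.1 := fun h => hstar p.1 (by rw [← h]; exact hp)
      simpa [pointMass, hne] using hq
    | succ t =>
      set n := t + 1 with hn
      obtain ⟨y, hy, hdom⟩ := exists_dominating hΔ hΔ1 hp hq.le (by
        rw [mul_clipThreshold hN hm]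
        linarith [min_le_right ε Δ])
      have hsum : ∑ τ ∈ range n, roundValue ε astar r τ p + n * (3 / 4 * Δ)
          ≤ ∑ a, y a * ∑ τ ∈ range n, roundValue ε astar r τ ⟨p.1, a⟩ := by
        calc _ = ∑ τ ∈ range n, (roundValue ε astar r τ p + 3 / 4 * Δ) := by
              rw [Finset.sum_add_distrib]; simp
          _ ≤ ∑ τ ∈ range n, ∑ a, y a * roundValue ε astar r τ ⟨p.1, a⟩ := by
              refine Finset.sum_le_sum fun τ hτ => ?_
              have hτ' : τ < n := mem_range.1 hτ
              exact hdom _ (hedge_mem_stdSimplex ε astar r τ)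
                fun c hc => (ih τ hτ' (by omega) hc).le
          _ = _ := by rw [Finset.sum_comm]; simp_rw [Finset.mul_sum]
      obtain ⟨a', ha'⟩ : ∃ a', ∑ τ ∈ range n, roundValue ε astar r τ p + n * (3 / 4 * Δ)
          ≤ ∑ τ ∈ range n, roundValue ε astar r τ ⟨p.1, a'⟩ := by
        by_contra! hcon
        refine absurd hsum (not_le.2 ?_)
        set c := ∑ τ ∈ range n, roundValue ε astar r τ p + n * (3 / 4 * Δ)
        calc _ < ∑ a, y a * c := by
              refine Finset.sum_lt_sum
                (fun a _ => mul_le_mul_of_nonneg_left (hcon a).le (hy.1 a)) ?_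
              obtain ⟨a, -, ha⟩ := Finset.exists_lt_of_sum_lt
                (s := univ) (f := fun _ : A p.1 => (0 : ℝ)) (g := y) (by simp [hy.2])
              exact ⟨a, mem_univ a, mul_lt_mul_of_pos_left (hcon a) ha⟩
          _ = c := by rw [← Finset.sum_mul, hy.2, one_mul]
      have h₁ := (abs_lt.1 (hacc n (by omega) ht p)).2
      have h₂ := (abs_lt.1 (hacc n (by omega) ht ⟨p.1, a'⟩)).1
      rw [Finset.sum_sub_distrib] at h₁ h₂
      have hgap : n * (Δ / 4) < ∑ τ ∈ range n, roundPayoff r τ ⟨p.1, a'⟩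
          - ∑ τ ∈ range n, roundPayoff r τ p := by linarith
      rw [hedge_succ]
      refine (softmax_le _ _ p.2 a').trans_lt ?_
      rw [← Real.lt_log_iff_exp_lt hq]
      have hn0 : (0 : ℝ) < n := by positivity
      have hη := learningRate_pos hN hm hε hΔ hε1 (t := n) (by omega)
      have hη' : 4 * Real.log (1 / clipThreshold N (maxActions A) ε Δ) / (Δ * n)
          ≤ learningRate N (maxActions A) ε Δ n := le_max_right _ _
      rw [div_le_iff₀ (by positivity), one_div, Real.log_inv] at hη'
      have := mul_lt_mul_of_pos_left hgap hη
      change -(learningRate N (maxActions A) ε Δ n * (∑ τ ∈ range n, roundPayoff r τ ⟨p.1, a'⟩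
          - ∑ τ ∈ range n, roundPayoff r τ p)) < _
      linarith

/-- The regret of Hedge against the estimated payoffs. -/
lemma hedge_estimated_regret_le (hN : 1 ≤ N) (hε : 0 < ε) (hε1 : ε ≤ 1) (hΔ : 0 < Δ)
    (hr : ∀ s, r s ∈ Set.Icc (0 : ℝ) 1) (hT : 1 ≤ T) (i : Fin N) (a : A i) :
    ∑ τ ∈ range T, roundPayoff r τ ⟨i, a⟩
        - ∑ τ ∈ range T, ∑ b, hedge ε astar r τ i b * roundPayoff r τ ⟨i, b⟩
      ≤ 1 + 2 * √(T * Real.log (maxActions A))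
        + 2 * Real.log (1 / clipThreshold N (maxActions A) ε Δ) / Δ * (1 + Real.log T) := by
  have hm : 1 ≤ maxActions A := one_le_maxActions hN
  have h := hedge_regret_le (η := learningRate N (maxActions A) ε Δ)
    (fun t => learningRate_pos hN hm hε hΔ hε1) (fun t => learningRate_succ_le hN hm hε hΔ hε1)
    (v := fun t a => roundPayoff r t ⟨i, a⟩) (θ := fun t => hedge ε astar r t i)
    (fun t a => roundPayoff_mem hr t _)
    (fun t ht => by
      obtain ⟨s, rfl⟩ : ∃ s, t = s + 1 := ⟨t - 1, by omega⟩
      exact hedge_succ ..) hT a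
  have hη := learningRate_pos hN hm hε hΔ hε1 hT
  have h₁ : Real.log (Fintype.card (A i)) / learningRate N (maxActions A) ε Δ T
      ≤ √(T * Real.log (maxActions A)) := by
    refine le_trans ?_ (log_div_learningRate_le hN hm hε hΔ hε1 hT)
    gcongr
    exact card_le_maxActions i
  have h₂ := sum_learningRate_le hN hm hε hΔ hε1 T
  have h₃ : ∑ t ∈ Ico 1 T, ∑ b, hedge ε astar r t i b * roundPayoff r t ⟨i, b⟩
      ≤ ∑ τ ∈ range T, ∑ b, hedge ε astar r τ i b * roundPayoff r τ ⟨i, b⟩ := by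
    refine Finset.sum_le_sum_of_subset_of_nonneg (fun t ht => by simp at ht ⊢; omega) ?_
    exact fun t _ _ => Finset.sum_nonneg fun b _ =>
      mul_nonneg ((hedge_mem_stdSimplex ε astar r t i).1 b) (roundPayoff_mem hr t _).1
  rw [Finset.sum_add_distrib, ← Finset.sum_div] at h
  have h₄ : 2 * Real.log (1 / clipThreshold N (maxActions A) ε Δ) / Δ * (1 + Real.log T)
    = (4 * Real.log (1 / clipThreshold N (maxActions A) ε Δ) / Δ * (1 + Real.log T)) / 2 := by ring
  rw [h₄]
  linarith

end HedgeStrategies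

section RunConcentration

variable {N : ℕ} {A : Fin N → Type u} [∀ i, Fintype (A i)] {G : Game A} {ε Δ δ : ℝ} {T : ℕ}
  {Ω : Type v} [mΩ : MeasurableSpace Ω] {μ : Measure Ω}

/-- The payoff of the exploring player in play `s`. -/
def Run.payoff (R : Run G ε Δ δ T μ) (ω : Ω) (s : Slot G Δ δ T) : ℝ := R.fb s ω (Slot.explored s).1

/-- The expected payoff of the exploring player in play `s`, given the past. -/
def Run.meanPayoff (R : Run G ε Δ δ T μ) (ω : Ω) (s : Slot G Δ δ T) : ℝ :=
  deviationValue (strategyAt ε (fun l => R.prof l ω) (R.payoff ω) s) (Slot.explored s)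
    (G.util (Slot.explored s).1)

variable (R : Run G ε Δ δ T μ)

lemma Run.payoff_mem (ω : Ω) (s : Slot G Δ δ T) : R.payoff ω s ∈ Set.Icc (0 : ℝ) 1 :=
  R.fb_mem s ω _

lemma Run.measurable_payoff (s : Slot G Δ δ T) :
    Measurable[R.history ((R.time s : ℕ) + 1)] fun ω => R.payoff ω s := R.fb_adapted s _

lemma Run.measurableSet_act (s : Slot G Δ δ T) (b : ∀ j, A j) :
    MeasurableSet {ω | R.act s ω = b} := R.history.le _ _ (R.act_adapted s b)

/-- The strategies of a Hedge round are determined before the round. -/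
lemma Run.measurable_hedge (t : Fin T) (p : Σ i, A i)
    (m : Fin (batchSize N (maxActions A) Δ δ T (t + 1))) (i : Fin N) (b : A i) :
    Measurable[R.history (R.time (Sum.inr ⟨t, p, m⟩))]
      fun ω => hedge ε (R.prof (elimLength G Δ) ω) (R.payoff ω) t i b := by
  classical
  obtain ⟨t, ht⟩ := t
  set s : Slot G Δ δ T := Sum.inr ⟨⟨t, ht⟩, p, m⟩ with hs
  have hround : Slot.round s = elimLength G Δ + t := rfl
  cases t with
  | zero =>
    simp only [hedge_zero, pointMass]
    refine Measurable.ite ?_ measurable_const measurable_const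
    have : {ω | b = R.prof (elimLength G Δ) ω i}
        = ⋃ b' ∈ {b' : ∀ j, A j | b = b' i}, {ω | R.prof (elimLength G Δ) ω = b'} := by
      ext ω; simp
    rw [this]
    exact MeasurableSet.biUnion (Set.to_countable _) fun b' _ =>
      R.prof_adapted s _ le_rfl (by rw [hround]; omega) b'
  | succ t =>
    have hS : ∀ c : A i, Measurable[R.history (R.time s)]
        fun ω => ∑ τ ∈ range (t + 1), roundPayoff (R.payoff ω) τ ⟨i, c⟩ := by
      intro c
      refine Finset.measurable_fun_sum _ fun τ hτ => ?_
      have hτ' : τ < t + 1 := mem_range.1 hτ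
      have hτT : τ < T := by omega
      simp only [roundPayoff, hτT, dif_pos, hedgeAverage]
      refine Measurable.div_const (Finset.measurable_fun_sum _ fun k _ => ?_) _
      refine (R.measurable_payoff _).mono (R.history.mono ?_) le_rfl
      refine R.time_lt (Sum.inr ⟨⟨τ, hτT⟩, ⟨i, c⟩, k⟩) s ?_
      rw [hround]
      exact Nat.add_lt_add_left hτ' _
    simp only [hedge_succ, softmax]
    have hE : ∀ c : A i, Measurable[R.history (R.time s)] fun ω =>
        Real.exp (learningRate N (maxActions A) ε Δ (t + 1)
          * ∑ τ ∈ range (t + 1), roundPayoff (R.payoff ω) τ ⟨i, c⟩) := fun c =>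
      Real.measurable_exp.comp ((hS c).const_mul _)
    exact (hE b).div (Finset.measurable_fun_sum _ fun c _ => hE c)

lemma Run.condExp_payoff [IsProbabilityMeasure μ] (s : Slot G Δ δ T) :
    μ[fun ω => R.payoff ω s | R.history (R.time s)] =ᵐ[μ] fun ω => R.meanPayoff ω s := by
  classical
  set i := (Slot.explored s).1 with hi
  have hcomap : MeasurableSpace.comap (R.act s) (⊤ : MeasurableSpace (∀ j, A j)) ≤ mΩ := by
    rintro _ ⟨t, -, rfl⟩
    have : R.act s ⁻¹' t = ⋃ b ∈ t, {ω | R.act s ω = b} := by ext ω; simp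
    rw [this]
    exact MeasurableSet.biUnion (Set.to_countable t) fun b _ => R.measurableSet_act s b
  have hle : R.history (R.time s) ⊔
      MeasurableSpace.comap (R.act s) (⊤ : MeasurableSpace (∀ j, A j)) ≤ mΩ :=
    sup_le (R.history.le _) hcomap
  have h₁ : μ[μ[fun ω => R.fb s ω i | R.history (R.time s) ⊔
      MeasurableSpace.comap (R.act s) (⊤ : MeasurableSpace (∀ j, A j))] | R.history (R.time s)]
      =ᵐ[μ] μ[fun ω => R.fb s ω i | R.history (R.time s)] :=
    condExp_condExp_of_le le_sup_left hle
  have h₂ := condExp_congr_ae (m := R.history (R.time s)) (R.fb_mean s i)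
  have h₃ : (fun ω => G.util i (R.act s ω))
      = ∑ b, G.util i b • Set.indicator {ω | R.act s ω = b} (fun _ => (1 : ℝ)) := by
    funext ω
    rw [Finset.sum_apply, Finset.sum_eq_single (R.act s ω)]
    · simp
    · intro b _ hb
      simp [Set.indicator, hb.symm]
    · simp
  have hint : ∀ b : ∀ j, A j, Integrable
      (Set.indicator {ω | R.act s ω = b} (fun _ => (1 : ℝ))) μ := fun b =>
    (integrable_const (1 : ℝ)).indicator (R.measurableSet_act s b)
  have h₄ := condExp_finsetSum (s := univ)
    (fun b _ => (hint b).smul (G.util i b)) (R.history (R.time s))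
  rw [← h₃] at h₄
  have h₅ : ∀ b, μ[G.util i b • Set.indicator {ω | R.act s ω = b} (fun _ => (1 : ℝ)) |
      R.history (R.time s)] =ᵐ[μ] fun ω => G.util i b * explorationLaw
        (strategyAt ε (fun l => R.prof l ω) (R.payoff ω) s) (Slot.explored s) b := fun b => by
    filter_upwards [condExp_smul (μ := μ) (G.util i b)
      (Set.indicator {ω | R.act s ω = b} (fun _ => (1 : ℝ))) (R.history (R.time s)),
      R.act_law s b] with ω h h'
    rw [h, Pi.smul_apply, smul_eq_mul, h']
    rfl
  filter_upwards [h₁, h₂, h₄, ae_all_iff.2 h₅] with ω h₁ h₂ h₄ h₅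
  change (μ[fun ω => R.fb s ω i | R.history (R.time s)]) ω = _
  rw [← h₁, h₂, h₄, Finset.sum_apply]
  simp_rw [h₅]
  exact Finset.sum_congr rfl fun b _ => mul_comm _ _

variable [IsProbabilityMeasure μ]

/-- Concentration of the weighted deviations of the payoffs, with predictable weights. -/
lemma Run.measure_weighted_sum_ge_le {w : Slot G Δ δ T → Ω → ℝ}
    (hwm : ∀ s, Measurable[R.history (R.time s)] (w s)) {V : ℝ} (hV : 0 < V)
    (hwV : ∀ ω, ∑ s, w s ω ^ 2 ≤ V) {c : ℝ} (hc : 0 ≤ c) :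
    μ {ω | c ≤ ∑ s, w s ω * (R.payoff ω s - R.meanPayoff ω s)}
      ≤ ENNReal.ofReal (Real.exp (-(c ^ 2 / (2 * V)))) := by
  set n := sampleCount G Δ δ T with hn
  set X : ℕ → Ω → ℝ := fun k ω =>
    if h : k < n then R.payoff ω (R.time.symm ⟨k, h⟩) else 0 with hX
  set w' : ℕ → Ω → ℝ := fun k ω => if h : k < n then w (R.time.symm ⟨k, h⟩) ω else 0 with hw'
  have hsum : ∀ f : Slot G Δ δ T → ℝ,
      ∑ s, f s = ∑ k ∈ range n, if h : k < n then f (R.time.symm ⟨k, h⟩) else 0 := fun f => by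
    rw [Finset.sum_range, ← Equiv.sum_comp R.time.symm]
    exact Finset.sum_congr rfl fun k _ => by simp
  have hws : ∀ ω, ∑ k ∈ range n, w' k ω ^ 2 ≤ V := fun ω => by
    refine le_trans (le_of_eq ?_) (hwV ω)
    rw [hsum]
    exact Finset.sum_congr rfl fun k hk => by simp [hw', mem_range.1 hk]
  have key := RationalizableCCE.measure_weighted_sum_ge_le (μ := μ) R.history (X := X) (w := w')
    (n := n) (V := V) (c := c)
    (fun k => by
      by_cases h : k < n
      · have := R.measurable_payoff (R.time.symm ⟨k, h⟩)
        rw [Equiv.apply_symm_apply] at this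
        simpa [hX, h] using this
      · simp only [hX, h, dif_neg, not_false_eq_true]
        exact measurable_const)
    (fun k ω => by
      simp only [hX]
      split_ifs
      exacts [R.payoff_mem _ _, by simp])
    (fun k => by
      by_cases h : k < n
      · have := hwm (R.time.symm ⟨k, h⟩)
        rw [Equiv.apply_symm_apply] at this
        simpa [hw', h] using this
      · simp only [hw', h, dif_neg, not_false_eq_true]
        exact measurable_const)
    hV
    (fun k ω => by
      by_cases h : k < n
      · exact (Finset.single_le_sum (f := fun k => w' k ω ^ 2) (fun k _ => sq_nonneg _)
          (mem_range.2 h)).trans (hws ω)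
      · simp [hw', h, hV.le])
    hws hc
  refine le_trans (measure_mono_ae ?_) key
  have hae : ∀ᵐ ω ∂μ, ∀ s, (μ[fun ω => R.payoff ω s | R.history (R.time s)]) ω
      = R.meanPayoff ω s := ae_all_iff.2 fun s => R.condExp_payoff s
  filter_upwards [hae] with ω hω hmem
  change c ≤ _ at hmem
  change c ≤ _
  rw [hsum] at hmem
  refine hmem.trans (le_of_eq (Finset.sum_congr rfl fun k hk => ?_))
  have hkn : k < n := mem_range.1 hk
  have h := hω (R.time.symm ⟨k, hkn⟩)
  simp only [Equiv.apply_symm_apply] at h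
  have hXk : X k = fun ω => R.payoff ω (R.time.symm ⟨k, hkn⟩) := by
    funext ω; simp [hX, hkn]
  rw [dif_pos hkn, hXk, h]
  simp [hw', hkn]

/-- Concentration of the average payoffs in the best response phase. -/
lemma Run.measure_initAverage_sub_ge_le (l : Fin (elimLength G Δ)) (p : Σ i, A i) {σ c : ℝ}
    (hσ : σ ^ 2 = 1) (hM : 0 < initBatchSize N (maxActions A) (elimLength G Δ) Δ δ) (hc : 0 ≤ c) :
    μ {ω | c ≤ σ * (initAverage (R.payoff ω) l p
        - G.util p.1 (Function.update (R.prof l ω) p.1 p.2))}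
      ≤ ENNReal.ofReal (Real.exp
        (-(c ^ 2 * initBatchSize N (maxActions A) (elimLength G Δ) Δ δ / 2))) := by
  classical
  have hM' : (0 : ℝ) < initBatchSize N (maxActions A) (elimLength G Δ) Δ δ := by exact_mod_cast hM
  set w : Slot G Δ δ T → ℝ := Sum.elim
    (fun x => if x.1 = l then if x.2.1 = p then
      σ / initBatchSize N (maxActions A) (elimLength G Δ) Δ δ else 0 else 0)
    (fun _ => 0) with hw
  have hsum : ∀ f : Slot G Δ δ T → ℝ, (∀ s, w s = 0 → f s = 0) →
      ∑ s, f s = ∑ m, f (Sum.inl (l, p, m)) := by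
    intro f hf
    rw [Fintype.sum_sum_type, Finset.sum_eq_zero (fun x _ => hf (Sum.inr x) rfl), add_zero,
      Fintype.sum_prod_type, Finset.sum_eq_single l, Fintype.sum_prod_type,
      Finset.sum_eq_single p]
    · intro p' _ hp
      exact Finset.sum_eq_zero fun m _ => hf _ (by simp [hw, hp])
    · simp
    · intro l' _ hl
      exact Finset.sum_eq_zero fun m _ => hf _ (by simp [hw, hl])
    · simp
  have hwl : ∀ m, w (Sum.inl (l, p, m)) =
      σ / initBatchSize N (maxActions A) (elimLength G Δ) Δ δ := fun m => by simp [hw]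
  have key := R.measure_weighted_sum_ge_le (w := fun s _ => w s) (fun s => measurable_const)
    (V := 1 / initBatchSize N (maxActions A) (elimLength G Δ) Δ δ) (by positivity)
    (fun ω => by
      rw [hsum _ fun s hs => by rw [hs]; simp]
      simp only [hwl, div_pow, hσ, Finset.sum_const, card_univ, Fintype.card_fin, nsmul_eq_mul]
      apply le_of_eq
      field_simp) hc
  refine le_trans (measure_mono fun ω hω => ?_) (key.trans (le_of_eq ?_))
  · change c ≤ _ at hω
    change c ≤ _
    refine hω.trans (le_of_eq ?_)
    rw [hsum _ fun s hs => by rw [hs]; simp]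
    have hmean : ∀ m, R.meanPayoff ω (Sum.inl (l, p, m))
        = G.util p.1 (Function.update (R.prof l ω) p.1 p.2) := fun m =>
      deviationValue_pointMass (R.prof l ω) p (G.util p.1)
    simp only [hwl, hmean, ← Finset.mul_sum, Finset.sum_sub_distrib, initAverage]
    simp only [Finset.sum_const, card_univ, Fintype.card_fin, nsmul_eq_mul]
    field_simp
  · congr 3
    field_simp

/-- Concentration of weighted sums of the average payoffs in the Hedge phase. -/
lemma Run.measure_sum_hedgeAverage_sub_ge_le {a : Fin T → (Σ i, A i) → Ω → ℝ}
    (ham : ∀ t p m, Measurable[R.history (R.time (Sum.inr ⟨t, p, m⟩))] (a t p))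
    (hM : ∀ t : Fin T, 0 < batchSize N (maxActions A) Δ δ T (t + 1)) {V : ℝ} (hV : 0 < V)
    (haV : ∀ ω, ∑ t : Fin T, (∑ p, a t p ω ^ 2) / batchSize N (maxActions A) Δ δ T (t + 1) ≤ V)
    {c : ℝ} (hc : 0 ≤ c) :
    μ {ω | c ≤ ∑ t : Fin T, ∑ p, a t p ω * (roundPayoff (R.payoff ω) t p
        - roundValue ε (R.prof (elimLength G Δ) ω) (R.payoff ω) t p)}
      ≤ ENNReal.ofReal (Real.exp (-(c ^ 2 / (2 * V)))) := by
  set w : Slot G Δ δ T → Ω → ℝ := Sum.elim (fun _ _ => 0)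
    (fun x ω => a x.1 x.2.1 ω / batchSize N (maxActions A) Δ δ T (x.1 + 1)) with hw
  have hsum : ∀ f : Slot G Δ δ T → ℝ, (∀ x, f (Sum.inl x) = 0) →
      ∑ s, f s = ∑ t, ∑ p, ∑ m, f (Sum.inr ⟨t, p, m⟩) := by
    intro f hf
    rw [Fintype.sum_sum_type, Finset.sum_eq_zero (fun x _ => hf x), zero_add, Fintype.sum_sigma]
    exact Finset.sum_congr rfl fun t _ => Fintype.sum_prod_type _
  have key := R.measure_weighted_sum_ge_le (w := w)
    (fun s => by
      rcases s with x | ⟨t, p, m⟩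
      · exact measurable_const
      · exact (ham t p m).div_const _) hV
    (fun ω => by
      rw [hsum _ fun x => by simp [hw]]
      refine le_trans (le_of_eq (Finset.sum_congr rfl fun t _ => ?_)) (haV ω)
      have := hM t
      have hM' : (0 : ℝ) < batchSize N (maxActions A) Δ δ T (t + 1) := by exact_mod_cast this
      rw [Finset.sum_div]
      refine Finset.sum_congr rfl fun p _ => ?_
      simp only [hw, Sum.elim_inr, Finset.sum_const, card_univ, Fintype.card_fin, nsmul_eq_mul]
      field_simp) hc
  refine le_trans (measure_mono fun ω hω => ?_) key
  change c ≤ _ at hω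
  change c ≤ _
  refine hω.trans (le_of_eq ?_)
  rw [hsum _ fun x => by simp [hw]]
  refine Finset.sum_congr rfl fun t _ => Finset.sum_congr rfl fun p _ => ?_
  have hM' : (0 : ℝ) < batchSize N (maxActions A) Δ δ T (t + 1) := by exact_mod_cast hM t
  have hmean : ∀ m, R.meanPayoff ω (Sum.inr ⟨t, p, m⟩)
      = roundValue ε (R.prof (elimLength G Δ) ω) (R.payoff ω) t p := fun m => rfl
  simp only [hw, Sum.elim_inr, hmean, ← Finset.mul_sum, Finset.sum_sub_distrib, roundPayoff,
    Fin.is_lt, dif_pos, hedgeAverage]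
  simp only [Finset.sum_const, card_univ, Fintype.card_fin, nsmul_eq_mul]
  field_simp

end RunConcentration

section Rounds

/-- The logarithmic factor of the number of rounds. -/
def logFactor (n m : ℕ) (ε Δ δ : ℝ) : ℝ := Real.log (2 * n * m / (ε * Δ * δ))

/-- A sufficient number of Hedge rounds. -/
def numRounds (n m : ℕ) (ε Δ δ : ℝ) : ℕ :=
  ⌈1000 * logFactor n m ε Δ δ ^ 2 * (1 / ε ^ 2 + 1 / (ε * Δ))⌉₊

lemma le_numRounds (n m : ℕ) (ε Δ δ : ℝ) :
    1000 * logFactor n m ε Δ δ ^ 2 * (1 / ε ^ 2 + 1 / (ε * Δ))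
    ≤ numRounds n m ε Δ δ := Nat.le_ceil _

/-- The admissible parameters of the algorithm. -/
structure Admissible (n m : ℕ) (ε Δ δ : ℝ) : Prop where
  one_le_players : 1 ≤ n
  one_le_actions : 1 ≤ m
  eps_pos : 0 < ε
  eps_le_one : ε ≤ 1
  gap_pos : 0 < Δ
  gap_le_one : Δ ≤ 1
  conf_pos : 0 < δ
  conf_lt_one : δ < 1

variable {n m : ℕ} {ε Δ δ : ℝ}

namespace Admissible

lemma one_le_mul (H : Admissible n m ε Δ δ) : (1 : ℝ) ≤ n * m := by
  exact_mod_cast Nat.mul_le_mul H.one_le_players H.one_le_actions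

lemma log_le_logFactor (H : Admissible n m ε Δ δ)
    {x : ℝ} (hx : 0 < x) (h : x * (ε * Δ * δ) ≤ 2 * (n * m)) :
    Real.log x ≤ logFactor n m ε Δ δ := by
  have := H.eps_pos
  have := H.gap_pos
  have := H.conf_pos
  refine Real.log_le_log hx ((le_div_iff₀ (by positivity)).2 ?_)
  linarith

lemma eps_mul_gap_le_one (H : Admissible n m ε Δ δ) :
    ε * Δ ≤ 1 := mul_le_one₀ H.eps_le_one H.gap_pos.le H.gap_le_one

lemma eps_mul_gap_mul_conf_le_one (H : Admissible n m ε Δ δ) : ε * Δ * δ ≤ 1 :=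
  mul_le_one₀ H.eps_mul_gap_le_one H.conf_pos.le H.conf_lt_one.le

lemma log_two_le_logFactor (H : Admissible n m ε Δ δ) : Real.log 2 ≤ logFactor n m ε Δ δ :=
  H.log_le_logFactor two_pos (by linarith [H.one_le_mul, H.eps_mul_gap_mul_conf_le_one])

lemma lt_logFactor (H : Admissible n m ε Δ δ) : 0.69 < logFactor n m ε Δ δ := by
  linarith [H.log_two_le_logFactor, Real.log_two_gt_d9]

lemma log_actions_le_logFactor (H : Admissible n m ε Δ δ) : Real.log m ≤ logFactor n m ε Δ δ := by
  have hm : (1 : ℝ) ≤ m := by exact_mod_cast H.one_le_actions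
  have hn : (1 : ℝ) ≤ n := by exact_mod_cast H.one_le_players
  refine H.log_le_logFactor (by linarith) ?_
  nlinarith [H.eps_mul_gap_mul_conf_le_one]

lemma log_div_conf_le_logFactor (H : Admissible n m ε Δ δ) :
    Real.log (2 * (n * m) / δ) ≤ logFactor n m ε Δ δ := by
  have h := H.one_le_mul
  have hδ := H.conf_pos
  refine H.log_le_logFactor (by positivity) ?_
  rw [show 2 * (n * m : ℝ) / δ * (ε * Δ * δ) = 2 * (n * m) * (ε * Δ) by field_simp]
  exact mul_le_of_le_one_right (by positivity) H.eps_mul_gap_le_one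

lemma log_one_div_eps_mul_gap_le_logFactor (H : Admissible n m ε Δ δ) :
    Real.log (1 / (ε * Δ)) ≤ logFactor n m ε Δ δ := by
  have := H.eps_pos
  have := H.gap_pos
  refine H.log_le_logFactor (by positivity) ?_
  rw [show 1 / (ε * Δ) * (ε * Δ * δ) = δ by field_simp]
  linarith [H.one_le_mul, H.conf_lt_one]

lemma log_logFactor_le (H : Admissible n m ε Δ δ) :
    Real.log (logFactor n m ε Δ δ) ≤ logFactor n m ε Δ δ := by
  have h := H.lt_logFactor
  linarith [Real.log_le_sub_one_of_pos (show 0 < logFactor n m ε Δ δ by linarith)]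

lemma log_one_div_clipThreshold_le (H : Admissible n m ε Δ δ) :
    Real.log (1 / clipThreshold n m ε Δ) ≤ 3 * logFactor n m ε Δ δ := by
  have hnm := H.one_le_mul
  have hε := H.eps_pos
  have hΔ := H.gap_pos
  have hδ := H.conf_pos
  have hp := clipThreshold_pos H.one_le_players H.one_le_actions hε hΔ
  have hmin : ε * Δ ≤ min ε Δ :=
    le_min (mul_le_of_le_one_right hε.le H.gap_le_one) (mul_le_of_le_one_left hΔ.le H.eps_le_one)
  have h4 : Real.log 4 = 2 * Real.log 2 := by
    rw [show (4 : ℝ) = 2 ^ 2 by norm_num, Real.log_pow]; norm_num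
  have h : Real.log (1 / clipThreshold n m ε Δ / 4) ≤ logFactor n m ε Δ δ := by
    refine H.log_le_logFactor (by positivity) ?_
    have hmul := mul_clipThreshold (ε := ε) (Δ := Δ) H.one_le_players H.one_le_actions
    rw [div_div, div_mul_eq_mul_div, one_mul, div_le_iff₀ (by positivity)]
    have : ε * Δ * δ ≤ ε * Δ := mul_le_of_le_one_right (by positivity) H.conf_lt_one.le
    nlinarith
  rw [Real.log_div (by positivity) (by norm_num)] at h
  linarith [H.log_two_le_logFactor]

lemma one_le_one_div_eps_sq (H : Admissible n m ε Δ δ) : 1 ≤ 1 / ε ^ 2 :=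
  (one_le_div (pow_pos H.eps_pos 2)).2 (pow_le_one₀ H.eps_pos.le H.eps_le_one)

lemma one_le_one_div_gap_sq (H : Admissible n m ε Δ δ) : 1 ≤ 1 / Δ ^ 2 :=
  (one_le_div (pow_pos H.gap_pos 2)).2 (pow_le_one₀ H.gap_pos.le H.gap_le_one)

lemma one_le_one_div_eps_mul_gap (H : Admissible n m ε Δ δ) : 1 ≤ 1 / (ε * Δ) :=
  (one_le_div (mul_pos H.eps_pos H.gap_pos)).2 H.eps_mul_gap_le_one

lemma numRounds_le (H : Admissible n m ε Δ δ) : (numRounds n m ε Δ δ : ℝ)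
    ≤ 1002 * logFactor n m ε Δ δ ^ 2 * (1 / ε ^ 2 + 1 / (ε * Δ)) := by
  have h₁ := H.one_le_one_div_eps_sq
  have h₂ := H.one_le_one_div_eps_mul_gap
  have h₃ : 0.47 ≤ logFactor n m ε Δ δ ^ 2 := by nlinarith [H.lt_logFactor]
  set Y := 1 / ε ^ 2 + 1 / (ε * Δ) with hY
  have hY2 : 2 ≤ Y := by linarith
  have h := Nat.ceil_lt_add_one (R := ℝ)
    (show 0 ≤ 1000 * logFactor n m ε Δ δ ^ 2 * Y by positivity)
  change (numRounds n m ε Δ δ : ℝ) < _ at h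
  nlinarith

lemma one_le_numRounds (H : Admissible n m ε Δ δ) : 1 ≤ numRounds n m ε Δ δ := by
  have h₁ := H.one_le_one_div_eps_sq
  have h₂ := H.one_le_one_div_eps_mul_gap
  have h₃ : 0.47 ≤ logFactor n m ε Δ δ ^ 2 := by nlinarith [H.lt_logFactor]
  have : (1 : ℝ) ≤ numRounds n m ε Δ δ := le_trans (by nlinarith) (le_numRounds n m ε Δ δ)
  exact_mod_cast this

/-- After `numRounds` rounds the regret per round is below `ε / 2`. -/
lemma regret_bound_le (H : Admissible n m ε Δ δ) {T : ℕ} (hT : numRounds n m ε Δ δ ≤ T) :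
    1 + 2 * √(T * Real.log m)
        + 2 * Real.log (1 / clipThreshold n m ε Δ) / Δ * (1 + Real.log T)
        + 2 * √(2 * T * Real.log (2 * (n * m) / δ)) ≤ ε / 2 * T := by
  set Λ := logFactor n m ε Δ δ with hΛ
  have hε := H.eps_pos
  have hΔ := H.gap_pos
  have hΛ0 : 0.69 < Λ := H.lt_logFactor
  have hT1 : (1 : ℝ) ≤ T := by exact_mod_cast H.one_le_numRounds.trans hT
  have hTge : 1000 * Λ ^ 2 * (1 / ε ^ 2 + 1 / (ε * Δ)) ≤ T :=
    (le_numRounds n m ε Δ δ).trans (by exact_mod_cast hT)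
  have hpos₁ : 0 ≤ 1000 * Λ ^ 2 * (1 / ε ^ 2) := by positivity
  have hpos₂ : 0 ≤ 1000 * Λ ^ 2 * (1 / (ε * Δ)) := by positivity
  have hT₁ : 1000 * Λ ^ 2 ≤ ε ^ 2 * T := by
    have : 1000 * Λ ^ 2 * (1 / ε ^ 2) ≤ T := by linarith
    rw [mul_one_div, div_le_iff₀ (by positivity)] at this
    linarith
  have hT₂ : 1000 * Λ ^ 2 / Δ ≤ ε * T := by
    have : 1000 * Λ ^ 2 * (1 / (ε * Δ)) ≤ T := by linarith
    rw [mul_one_div, div_le_iff₀ (by positivity)] at this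
    rw [div_le_iff₀ hΔ]
    linarith
  have hΛT : 600 * Λ ≤ ε ^ 2 * T := by nlinarith
  have hs₁ : √(T * Real.log m) ≤ ε * T / 20 := by
    refine Real.sqrt_le_iff.2 ⟨by positivity, ?_⟩
    nlinarith [mul_le_mul_of_nonneg_left H.log_actions_le_logFactor (by linarith : (0 : ℝ) ≤ T),
      mul_le_mul_of_nonneg_left hΛT (by linarith : (0 : ℝ) ≤ T)]
  have hs₂ : √(2 * T * Real.log (2 * (n * m) / δ)) ≤ ε * T / 16 := by
    refine Real.sqrt_le_iff.2 ⟨by positivity, ?_⟩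
    nlinarith [mul_le_mul_of_nonneg_left H.log_div_conf_le_logFactor (by linarith : (0 : ℝ) ≤ T),
      mul_le_mul_of_nonneg_left hΛT (by linarith : (0 : ℝ) ≤ T)]
  set K := 64 * Λ * (1 / (ε * Δ)) with hK
  have hKpos : 0 < K := by positivity
  have hlogK : Real.log K ≤ 8 * Λ := by
    have h64 : Real.log 64 = 6 * Real.log 2 := by
      rw [show (64 : ℝ) = 2 ^ 6 by norm_num, Real.log_pow]; norm_num
    rw [hK, Real.log_mul (by positivity) (by positivity),
      Real.log_mul (by norm_num) (by positivity), h64]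
    linarith [H.log_two_le_logFactor, H.log_logFactor_le, H.log_one_div_eps_mul_gap_le_logFactor]
  have hlogT : 1 + Real.log T ≤ 8 * Λ + T / K := by
    have h := Real.log_le_sub_one_of_pos (show 0 < (T : ℝ) / K by positivity)
    rw [Real.log_div (by positivity) (by positivity)] at h
    linarith
  have hlogT0 : 0 ≤ Real.log T := Real.log_nonneg hT1
  have hΛΔ : 1 ≤ 2 * Λ / Δ := by
    rw [le_div_iff₀ hΔ]; linarith [H.gap_le_one]
  have hmain : 1 + 2 * Real.log (1 / clipThreshold n m ε Δ) / Δ * (1 + Real.log T)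
      ≤ ε * T / 4 := by
    calc _ ≤ 2 * Λ / Δ * (1 + Real.log T) + 2 * (3 * Λ) / Δ * (1 + Real.log T) := by
          gcongr
          · nlinarith
          · exact H.log_one_div_clipThreshold_le
      _ = 8 * Λ / Δ * (1 + Real.log T) := by ring
      _ ≤ 8 * Λ / Δ * (8 * Λ + T / K) := by gcongr
      _ = 64 * Λ ^ 2 / Δ + ε * T / 8 := by rw [hK]; field_simp; ring
      _ ≤ _ := by
          have : 64 * Λ ^ 2 / Δ = 64 / 1000 * (1000 * Λ ^ 2 / Δ) := by ring
          rw [this]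
          linarith [mul_pos hε (by linarith : (0 : ℝ) < T)]
  nlinarith [mul_pos hε (by linarith : (0 : ℝ) < T)]

lemma log_numRounds_le (H : Admissible n m ε Δ δ) :
    Real.log (numRounds n m ε Δ δ) ≤ 15 * logFactor n m ε Δ δ := by
  set Λ := logFactor n m ε Δ δ with hΛ
  have hε := H.eps_pos
  have hΔ := H.gap_pos
  have hΛ0 : 0.69 < Λ := H.lt_logFactor
  have hT1 : (1 : ℝ) ≤ numRounds n m ε Δ δ := by exact_mod_cast H.one_le_numRounds
  have hz := H.one_le_one_div_eps_mul_gap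
  have hle : (numRounds n m ε Δ δ : ℝ) ≤ 2 ^ 11 * (Λ ^ 2 * (1 / (ε * Δ)) ^ 2) := by
    refine H.numRounds_le.trans ?_
    have h₁ : 1 / ε ^ 2 ≤ (1 / (ε * Δ)) ^ 2 := by
      rw [div_pow, one_pow, mul_pow]
      gcongr
      exact mul_le_of_le_one_right (by positivity) (pow_le_one₀ hΔ.le H.gap_le_one)
    have h₂ : 1 / (ε * Δ) ≤ (1 / (ε * Δ)) ^ 2 := le_self_pow₀ hz (by norm_num)
    have h₃ : 0 ≤ Λ ^ 2 * (1 / (ε * Δ)) ^ 2 := by positivity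
    calc _ ≤ 1002 * Λ ^ 2 * ((1 / (ε * Δ)) ^ 2 + (1 / (ε * Δ)) ^ 2) := by gcongr
      _ ≤ _ := by linarith
  refine (Real.log_le_log (by linarith) hle).trans ?_
  rw [Real.log_mul (by positivity) (by positivity), Real.log_mul (by positivity) (by positivity),
    Real.log_pow, Real.log_pow, Real.log_pow]
  push_cast
  linarith [H.log_two_le_logFactor, H.log_logFactor_le, H.log_one_div_eps_mul_gap_le_logFactor]

lemma one_lt_mul_div_conf (H : Admissible n m ε Δ δ)
    {T : ℕ} (hT : 1 ≤ T) : 1 < (m * n * T / δ : ℝ) := by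
  rw [one_lt_div H.conf_pos]
  have : (1 : ℝ) ≤ T := by exact_mod_cast hT
  nlinarith [H.one_le_mul, H.conf_lt_one]

lemma batchSize_pos (H : Admissible n m ε Δ δ)
    {T t : ℕ} (hT : 1 ≤ T) (ht : 1 ≤ t) : 0 < batchSize n m Δ δ T t := by
  have := Real.log_pos (H.one_lt_mul_div_conf hT)
  have := H.gap_pos
  have : (0 : ℝ) < t := by exact_mod_cast ht
  exact Nat.ceil_pos.2 (by positivity)

lemma one_div_batchSize_le (H : Admissible n m ε Δ δ) {T t : ℕ} (hT : 1 ≤ T) (ht : 1 ≤ t) :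
    1 / (batchSize n m Δ δ T t : ℝ) ≤ Δ ^ 2 * t / (64 * Real.log (m * n * T / δ)) := by
  have h₁ := Real.log_pos (H.one_lt_mul_div_conf hT)
  have h₂ := H.gap_pos
  have h₃ : (0 : ℝ) < t := by exact_mod_cast ht
  have h : 64 * Real.log (m * n * T / δ) / (Δ ^ 2 * t) ≤ batchSize n m Δ δ T t := Nat.le_ceil _
  have hpos : 0 < 64 * Real.log (m * n * T / δ) / (Δ ^ 2 * t) := by positivity
  calc _ ≤ 1 / (64 * Real.log (m * n * T / δ) / (Δ ^ 2 * t)) := by gcongr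
    _ = _ := one_div_div _ _

lemma sum_batchSize_le (H : Admissible n m ε Δ δ) {T : ℕ} (hT : 1 ≤ T) :
    ∑ t : Fin T, (batchSize n m Δ δ T (t + 1) : ℝ)
      ≤ T + 64 * Real.log (m * n * T / δ) / Δ ^ 2 * (1 + Real.log T) := by
  have h₁ := Real.log_pos (H.one_lt_mul_div_conf hT)
  have h₂ := H.gap_pos
  calc _ ≤ ∑ t : Fin T, (1 + 64 * Real.log (m * n * T / δ) / Δ ^ 2 * (1 / ((t : ℕ) + 1 : ℝ))) := by
        refine Finset.sum_le_sum fun t _ => ?_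
        have h := (Nat.ceil_lt_add_one (R := ℝ)
          (show 0 ≤ 64 * Real.log (m * n * T / δ) / (Δ ^ 2 * ((t : ℕ) + 1 : ℕ)) by positivity)).le
        refine h.trans (le_of_eq ?_)
        push_cast
        field_simp
        ring
    _ = T + 64 * Real.log (m * n * T / δ) / Δ ^ 2 * ∑ t ∈ range T, 1 / ((t : ℝ) + 1) := by
        rw [Finset.sum_add_distrib, ← Finset.mul_sum,
          Fin.sum_univ_eq_sum_range (fun t => 1 / ((t : ℝ) + 1)) T]
        simp
    _ ≤ _ := by
        gcongr
        exact sum_one_div_le T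

lemma one_lt_length_mul_div_conf (H : Admissible n m ε Δ δ)
    {L : ℕ} (hL : 1 ≤ L) : 1 < (L * n * m / δ : ℝ) := by
  rw [one_lt_div H.conf_pos]
  have : (1 : ℝ) ≤ L := by exact_mod_cast hL
  nlinarith [H.one_le_mul, H.conf_lt_one]

lemma initBatchSize_pos (H : Admissible n m ε Δ δ)
    {L : ℕ} (hL : 1 ≤ L) : 0 < initBatchSize n m L Δ δ := by
  have := Real.log_pos (H.one_lt_length_mul_div_conf hL)
  have := H.gap_pos
  exact Nat.ceil_pos.2 (by positivity)

/-- The bound on the number of plays per explored action. -/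
lemma plays_per_action_le (H : Admissible n m ε Δ δ) {L : ℕ} (hL : 1 ≤ L) :
    (L * initBatchSize n m L Δ δ : ℝ)
        + ∑ t : Fin (numRounds n m ε Δ δ), (batchSize n m Δ δ (numRounds n m ε Δ δ) (t + 1) : ℝ)
      ≤ 30000 * Real.log (2 * n * m * L / (ε * Δ * δ)) ^ 2 * (L / Δ ^ 2 + 1 / ε ^ 2) := by
  set Λ := logFactor n m ε Δ δ with hΛ
  set T := numRounds n m ε Δ δ with hTdef
  set Λ' := Real.log (2 * n * m * L / (ε * Δ * δ)) with hΛ'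
  have hε := H.eps_pos
  have hΔ := H.gap_pos
  have hδ := H.conf_pos
  have hnm := H.one_le_mul
  have hΛ0 : 0.69 < Λ := H.lt_logFactor
  have hL1 : (1 : ℝ) ≤ L := by exact_mod_cast hL
  have hT1 : 1 ≤ T := H.one_le_numRounds
  have hT1' : (1 : ℝ) ≤ T := by exact_mod_cast hT1
  have hz := H.one_le_one_div_gap_sq
  have hz' := H.one_le_one_div_eps_sq
  have hnm' : (0 : ℝ) < 2 * n * m := by linarith
  have hΛle : Λ ≤ Λ' := by
    refine Real.log_le_log (by positivity) (div_le_div_of_nonneg_right ?_ (by positivity))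
    exact le_mul_of_one_le_right hnm'.le hL1
  have hΛ'0 : 0.69 < Λ' := by linarith
  have hinit : (initBatchSize n m L Δ δ : ℝ) ≤ 132 * Λ' ^ 2 * (1 / Δ ^ 2) := by
    have hpos := Real.log_pos (H.one_lt_length_mul_div_conf hL)
    have hlog : Real.log (L * n * m / δ) ≤ Λ' := by
      refine Real.log_le_log (by linarith [H.one_lt_length_mul_div_conf hL]) ?_
      rw [div_le_div_iff₀ hδ (by positivity)]
      have h₁ : (L * n * m : ℝ) * (ε * Δ * δ) ≤ (L * n * m) * δ := by
        gcongr
        exact mul_le_of_le_one_left hδ.le H.eps_mul_gap_le_one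
      have h₂ : (0 : ℝ) ≤ L * n * m * δ := by positivity
      linarith
    have h := (Nat.ceil_lt_add_one (R := ℝ)
      (show 0 ≤ 64 * Real.log (L * n * m / δ) / Δ ^ 2 by positivity)).le
    calc (initBatchSize n m L Δ δ : ℝ) ≤ _ := h
      _ ≤ 64 * Λ' / Δ ^ 2 + 2 * Λ' * (1 / Δ ^ 2) := by
          gcongr
          nlinarith
      _ = 66 * Λ' * (1 / Δ ^ 2) := by ring
      _ ≤ _ := by
          gcongr ?_ * _
          nlinarith
  have hlogT : Real.log T ≤ 15 * Λ := H.log_numRounds_le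
  have hlogT0 : 0 ≤ Real.log T := Real.log_nonneg hT1'
  have hlogmT : Real.log (m * n * T / δ) ≤ 16 * Λ := by
    have h₁ : (m * n * T / δ : ℝ) = (m * n / δ) * T := by ring
    have hpos : (0 : ℝ) < m * n / δ := div_pos (by linarith) hδ
    rw [h₁, Real.log_mul hpos.ne' (by positivity)]
    have h₂ : Real.log (m * n / δ) ≤ Real.log (2 * (n * m) / δ) := by
      refine Real.log_le_log hpos (div_le_div_of_nonneg_right ?_ hδ.le)
      linarith
    linarith [H.log_div_conf_le_logFactor]
  have hbatch : ∑ t : Fin T, (batchSize n m Δ δ T (t + 1) : ℝ)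
      ≤ Λ ^ 2 * (2004 * (1 / ε ^ 2) + 18410 * (1 / Δ ^ 2)) := by
    have hlogpos := Real.log_pos (H.one_lt_mul_div_conf hT1)
    have hTle := H.numRounds_le
    have hamgm : 1 / (ε * Δ) ≤ 1 / ε ^ 2 + 1 / Δ ^ 2 := by
      have e₁ : 1 / (ε * Δ) = 1 / ε * (1 / Δ) := by field_simp
      have e₂ : 1 / ε ^ 2 = (1 / ε) ^ 2 := by rw [div_pow, one_pow]
      have e₃ : 1 / Δ ^ 2 = (1 / Δ) ^ 2 := by rw [div_pow, one_pow]
      rw [e₁, e₂, e₃]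
      nlinarith [sq_nonneg (1 / ε - 1 / Δ), sq_nonneg (1 / ε + 1 / Δ)]
    calc _ ≤ T + 64 * Real.log (m * n * T / δ) / Δ ^ 2 * (1 + Real.log T) := H.sum_batchSize_le hT1
      _ ≤ 1002 * Λ ^ 2 * (1 / ε ^ 2 + (1 / ε ^ 2 + 1 / Δ ^ 2))
          + 64 * (16 * Λ) / Δ ^ 2 * (17 * Λ) := by
          gcongr
          · refine hTle.trans ?_
            gcongr
          · linarith
      _ = _ := by ring
  have hΛsq : Λ ^ 2 ≤ Λ' ^ 2 := by gcongr
  calc _ ≤ L * (132 * Λ' ^ 2 * (1 / Δ ^ 2))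
        + Λ' ^ 2 * (2004 * (1 / ε ^ 2) + 18410 * (L * (1 / Δ ^ 2))) := by
        refine add_le_add (by gcongr) (hbatch.trans ?_)
        gcongr
        nlinarith
    _ = Λ' ^ 2 * (2004 * (1 / ε ^ 2) + 18542 * (L / Δ ^ 2)) := by ring
    _ ≤ Λ' ^ 2 * (30000 * (1 / ε ^ 2) + 30000 * (L / Δ ^ 2)) := by
        have h₁ : 0 ≤ 1 / ε ^ 2 := by positivity
        have h₂ : 0 ≤ L / Δ ^ 2 := by positivity
        gcongr <;> norm_num
    _ = _ := by ring

end Admissible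

end Rounds

section UnionBounds

variable {Ω : Type v} [MeasurableSpace Ω] {μ : Measure Ω}

lemma measure_iUnion_le_ofReal {ι : Type*} [Fintype ι] {S : ι → Set Ω} {x y : ℝ}
    (h : ∀ i, μ (S i) ≤ ENNReal.ofReal x) (hxy : Fintype.card ι * x ≤ y) :
    μ (⋃ i, S i) ≤ ENNReal.ofReal y := by
  calc μ (⋃ i, S i) ≤ ∑ i, μ (S i) := measure_iUnion_fintype_le μ S
    _ ≤ ∑ _i : ι, ENNReal.ofReal x := Finset.sum_le_sum fun i _ => h i
    _ = ENNReal.ofReal (Fintype.card ι * x) := by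
        rw [Finset.sum_const, card_univ, nsmul_eq_mul, ENNReal.ofReal_mul (Nat.cast_nonneg _),
          ENNReal.ofReal_natCast]
    _ ≤ _ := ENNReal.ofReal_le_ofReal hxy

lemma measure_union_le_ofReal {S S' : Set Ω} {x : ℝ} (hx : 0 ≤ x) (h : μ S ≤ ENNReal.ofReal x)
    (h' : μ S' ≤ ENNReal.ofReal x) : μ (S ∪ S') ≤ ENNReal.ofReal (2 * x) := by
  refine (measure_union_le S S').trans ((add_le_add h h').trans (le_of_eq ?_))
  rw [← ENNReal.ofReal_add hx hx, two_mul]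

lemma exp_neg_two_mul_log {x : ℝ} (hx : 0 < x) : Real.exp (-(2 * Real.log x)) = 1 / x ^ 2 := by
  rw [Real.exp_neg, one_div, mul_comm, Real.exp_mul, Real.exp_log hx, Real.rpow_two]

lemma mul_two_div_sq_le {c K δ : ℝ} (hcK : c ≤ K) (hK : 1 ≤ K) (hδ : 0 < δ) (hδ2 : δ ≤ 1 / 2) :
    c * (2 * (1 / (K / δ) ^ 2)) ≤ δ := by
  calc c * (2 * (1 / (K / δ) ^ 2)) ≤ K * (2 * (1 / (K / δ) ^ 2)) := by gcongr
    _ = 2 * δ ^ 2 / K := by field_simp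
    _ ≤ 2 * δ ^ 2 / 1 := by gcongr
    _ ≤ δ := by nlinarith

end UnionBounds

section Events

variable {N : ℕ} {A : Fin N → Type u} [∀ i, Fintype (A i)] {G : Game A} {ε Δ δ : ℝ} {T : ℕ}
  {Ω : Type v} [mΩ : MeasurableSpace Ω] {μ : Measure Ω}

lemma card_sigma_le (A : Fin N → Type u) [∀ i, Fintype (A i)] :
    (Fintype.card (Σ i, A i) : ℝ) ≤ N * maxActions A := by
  rw [Fintype.card_sigma]
  push_cast
  calc ∑ i, (Fintype.card (A i) : ℝ) ≤ ∑ _i : Fin N, (maxActions A : ℝ) :=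
        Finset.sum_le_sum fun i _ => by exact_mod_cast card_le_maxActions i
    _ = _ := by simp

/-- Some average of the best response phase is off by at least `Δ / 2`. -/
def Run.initFailure (R : Run G ε Δ δ T μ) : Set Ω :=
  ⋃ x : Fin (elimLength G Δ) × (Σ i, A i), {ω | Δ / 2 ≤ |initAverage (R.payoff ω) x.1 x.2
    - G.util x.2.1 (Function.update (R.prof x.1 ω) x.2.1 x.2.2)|}

/-- Some cumulative estimate of the first `n` Hedge rounds is off by at least `n Δ / 4`. -/
def Run.estimateFailure (R : Run G ε Δ δ T μ) : Set Ω :=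
  ⋃ x : Fin T × (Σ i, A i), {ω | ((x.1 + 1 : ℕ) : ℝ) * (Δ / 4) ≤ |∑ τ ∈ range (x.1 + 1),
    (roundPayoff (R.payoff ω) τ x.2
      - roundValue ε (R.prof (elimLength G Δ) ω) (R.payoff ω) τ x.2)|}

/-- The bound on the influence of the estimation errors on the regret. -/
def regretTolerance (n m T : ℕ) (δ : ℝ) : ℝ := √(2 * T * Real.log (2 * (n * m) / δ))

/-- The estimation errors contribute too much to the regret for some deviation. -/
def Run.regretFailure (R : Run G ε Δ δ T μ) : Set Ω :=
  ⋃ p : Σ i, A i,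
    {ω | regretTolerance N (maxActions A) T δ ≤ ∑ τ ∈ range T,
      (roundValue ε (R.prof (elimLength G Δ) ω) (R.payoff ω) τ p - roundPayoff (R.payoff ω) τ p)} ∪
    {ω | regretTolerance N (maxActions A) T δ ≤ ∑ τ ∈ range T,
      ∑ b, hedge ε (R.prof (elimLength G Δ) ω) (R.payoff ω) τ p.1 b *
        (roundPayoff (R.payoff ω) τ ⟨p.1, b⟩
          - roundValue ε (R.prof (elimLength G Δ) ω) (R.payoff ω) τ ⟨p.1, b⟩)}

variable (R : Run G ε Δ δ T μ) [IsProbabilityMeasure μ]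

lemma Run.measure_initFailure_le (H : Admissible N (maxActions A) ε Δ δ) (hδ2 : δ ≤ 1 / 2) :
    μ R.initFailure ≤ ENNReal.ofReal δ := by
  have hL := (elimLength_spec G Δ).1
  set K : ℝ := elimLength G Δ * N * maxActions A with hK
  have hKδ : 1 < K / δ := H.one_lt_length_mul_div_conf hL
  have hK1 : 1 ≤ K := by
    have h₁ : (1 : ℝ) ≤ elimLength G Δ := by exact_mod_cast hL
    rw [hK, mul_assoc]
    exact one_le_mul_of_one_le_of_one_le h₁ H.one_le_mul
  have hlog := Real.log_pos hKδ
  have hΔ := H.gap_pos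
  have hM := H.initBatchSize_pos hL
  have hexp : Real.exp (-((Δ / 2) ^ 2 *
      initBatchSize N (maxActions A) (elimLength G Δ) Δ δ / 2)) ≤ 1 / (K / δ) ^ 2 := by
    rw [← exp_neg_two_mul_log (by linarith), Real.exp_le_exp, neg_le_neg_iff]
    have h : 64 * Real.log (K / δ) / Δ ^ 2 ≤ initBatchSize N (maxActions A) (elimLength G Δ) Δ δ :=
      Nat.le_ceil _
    rw [div_le_iff₀ (by positivity)] at h
    linarith
  refine measure_iUnion_le_ofReal (x := 2 * (1 / (K / δ) ^ 2)) (fun x => ?_)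
    (mul_two_div_sq_le ?_ hK1 H.conf_pos hδ2)
  · refine le_trans (measure_mono ?_) (measure_union_le_ofReal (by positivity)
      ((R.measure_initAverage_sub_ge_le x.1 x.2 (σ := 1) (c := Δ / 2) (by norm_num) hM
        (by positivity)).trans (ENNReal.ofReal_le_ofReal hexp))
      ((R.measure_initAverage_sub_ge_le x.1 x.2 (σ := -1) (c := Δ / 2) (by norm_num) hM
        (by positivity)).trans (ENNReal.ofReal_le_ofReal hexp)))
    intro ω hω
    rw [Set.mem_ofPred_eq, le_abs] at hω
    rcases hω with h | h
    · exact Or.inl (by simpa using h)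
    · exact Or.inr (by simpa using h)
  · rw [Fintype.card_prod, Fintype.card_fin, hK, mul_assoc]
    push_cast
    gcongr
    exact card_sigma_le A

lemma Run.measure_estimateFailure_le (H : Admissible N (maxActions A)
    ε Δ δ) (hδ2 : δ ≤ 1 / 2) (hT : 1 ≤ T) :
    μ R.estimateFailure ≤ ENNReal.ofReal δ := by
  classical
  set K : ℝ := maxActions A * N * T with hK
  have hKδ : 1 < K / δ := H.one_lt_mul_div_conf hT
  have hT1 : (1 : ℝ) ≤ T := by exact_mod_cast hT
  have hK1 : 1 ≤ K := by
    rw [hK, mul_comm (maxActions A : ℝ)]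
    exact one_le_mul_of_one_le_of_one_le H.one_le_mul hT1
  have hlog := Real.log_pos hKδ
  have hΔ := H.gap_pos
  have key : ∀ (x : Fin T × (Σ i, A i)) (σ : ℝ), σ ^ 2 = 1 →
      μ {ω | ((x.1 + 1 : ℕ) : ℝ) * (Δ / 4) ≤ σ * ∑ τ ∈ range (x.1 + 1),
        (roundPayoff (R.payoff ω) τ x.2
          - roundValue ε (R.prof (elimLength G Δ) ω) (R.payoff ω) τ x.2)}
        ≤ ENNReal.ofReal (1 / (K / δ) ^ 2) := by
    intro x σ hσ
    obtain ⟨n, hn⟩ : ∃ n : ℕ, n = (x.1 : ℕ) + 1 := ⟨_, rfl⟩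
    have hnT : n ≤ T := by have := x.1.2; omega
    have hn0 : (0 : ℝ) < n := by rw [hn]; positivity
    rw [← hn]
    have hfin : ∀ f : ℕ → ℝ,
        ∑ t : Fin T, (if (t : ℕ) < n then f t else 0) = ∑ τ ∈ range n, f τ := by
      intro f
      rw [Fin.sum_univ_eq_sum_range (fun t => if t < n then f t else 0), ← Finset.sum_filter]
      refine Finset.sum_congr ?_ fun _ _ => rfl
      ext τ
      simp only [mem_filter, mem_range]
      omega
    refine le_trans (measure_mono fun ω hω => ?_) ((R.measure_sum_hedgeAverage_sub_ge_le
      (a := fun t p _ => if (t : ℕ) < n then if p = x.2 then σ else 0 else 0)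
      (fun _ _ _ => measurable_const) (fun t => H.batchSize_pos hT (by omega))
      (V := Δ ^ 2 * n ^ 2 / (64 * Real.log (K / δ))) (by positivity) (fun ω => ?_)
      (c := n * (Δ / 4)) (by positivity)).trans (ENNReal.ofReal_le_ofReal (le_of_eq ?_)))
    · rw [Set.mem_ofPred_eq] at hω ⊢
      refine hω.trans (le_of_eq ?_)
      rw [← hfin, Finset.mul_sum]
      refine Finset.sum_congr rfl fun t _ => ?_
      by_cases h : (t : ℕ) < n
      · simp only [h, if_true, ite_mul, zero_mul]
        rw [Finset.sum_ite_eq' univ x.2]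
        simp
      · simp [h]
    · have hsq : ∀ t : Fin T, (∑ p, (if (t : ℕ) < n then if p = x.2 then σ else 0 else 0) ^ 2)
          / (batchSize N (maxActions A) Δ δ T (t + 1) : ℝ)
          = if (t : ℕ) < n then 1 / (batchSize N (maxActions A) Δ δ T (t + 1) : ℝ) else 0 := by
        intro t
        split_ifs with h
        · simp [ite_pow, hσ]
        · simp
      simp_rw [hsq]
      rw [hfin fun t => 1 / (batchSize N (maxActions A) Δ δ T (t + 1) : ℝ)]
      calc _ ≤ ∑ τ ∈ range n, Δ ^ 2 * n / (64 * Real.log (K / δ)) := by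
            refine Finset.sum_le_sum fun τ hτ => ?_
            refine (H.one_div_batchSize_le hT (by omega)).trans ?_
            gcongr
            exact mem_range.1 hτ
        _ = _ := by rw [Finset.sum_const, card_range, nsmul_eq_mul]; ring
    · rw [← exp_neg_two_mul_log (by linarith)]
      congr 2
      field_simp
      norm_num
  refine measure_iUnion_le_ofReal (x := 2 * (1 / (K / δ) ^ 2)) (fun x => ?_)
    (mul_two_div_sq_le ?_ hK1 H.conf_pos hδ2)
  · refine le_trans (measure_mono ?_) (measure_union_le_ofReal (by positivity)
      (key x 1 (by norm_num)) (key x (-1) (by norm_num)))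
    intro ω hω
    rw [Set.mem_ofPred_eq, le_abs] at hω
    rcases hω with h | h
    · exact Or.inl (by simpa only [Set.mem_ofPred_eq, one_mul] using h)
    · exact Or.inr (by simpa only [Set.mem_ofPred_eq, neg_mul, one_mul] using h)
  · rw [Fintype.card_prod, Fintype.card_fin, hK]
    push_cast
    calc (T : ℝ) * Fintype.card (Σ i, A i) ≤ T * (N * maxActions A) := by
          gcongr; exact card_sigma_le A
      _ = _ := by ring

lemma Run.measure_regretFailure_le (H : Admissible N (maxActions A)
    ε Δ δ) [∀ i, Nonempty (A i)] (hT : 1 ≤ T) :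
    μ R.regretFailure ≤ ENNReal.ofReal δ := by
  classical
  have hδ := H.conf_pos
  have hnm := H.one_le_mul
  have hT1 : (1 : ℝ) ≤ T := by exact_mod_cast hT
  set K : ℝ := 2 * (N * maxActions A) with hK
  have hKδ : 1 < K / δ := by rw [one_lt_div hδ]; linarith [H.conf_lt_one]
  have hlog := Real.log_pos hKδ
  have hexp : Real.exp (-(regretTolerance N (maxActions A) T δ ^ 2 / (2 * T))) = δ / K := by
    rw [regretTolerance, Real.sq_sqrt (by positivity), mul_div_right_comm, div_self (by positivity),
      one_mul, Real.exp_neg, Real.exp_log (by positivity), inv_div]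
  have key : ∀ a : Fin T → (Σ i, A i) → Ω → ℝ,
      (∀ t p m, Measurable[R.history (R.time (Sum.inr ⟨t, p, m⟩))] (a t p)) →
      (∀ t ω, ∑ p, a t p ω ^ 2 ≤ 1) →
      μ {ω | regretTolerance N (maxActions A) T δ ≤ ∑ t : Fin T, ∑ p, a t p ω *
        (roundPayoff (R.payoff ω) t p
          - roundValue ε (R.prof (elimLength G Δ) ω) (R.payoff ω) t p)}
        ≤ ENNReal.ofReal (δ / K) := by
    intro a ham ha
    rw [← hexp]
    refine R.measure_sum_hedgeAverage_sub_ge_le ham (fun t => H.batchSize_pos hT (by omega))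
      (by linarith) (fun ω => ?_) (Real.sqrt_nonneg _)
    calc _ ≤ ∑ _t : Fin T, (1 : ℝ) := by
          refine Finset.sum_le_sum fun t _ => div_le_one_of_le₀ ((ha t ω).trans ?_)
            (Nat.cast_nonneg _)
          have : 1 ≤ batchSize N (maxActions A) Δ δ T (t + 1) := H.batchSize_pos hT (by omega)
          exact_mod_cast this
      _ = T := by simp
  refine measure_iUnion_le_ofReal (x := 2 * (δ / K)) (fun p => ?_) ?_
  · refine measure_union_le_ofReal (by positivity) (le_trans (measure_mono fun ω hω => ?_)
      (key (fun _ p' _ => if p' = p then -1 else 0) (fun _ _ _ => measurable_const)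
        fun t ω => by simp [ite_pow]))
      (le_trans (measure_mono fun ω hω => ?_) (key (fun t p' ω => if p'.1 = p.1 then
        hedge ε (R.prof (elimLength G Δ) ω) (R.payoff ω) t p'.1 p'.2 else 0)
        (fun t p' m => ?_) fun t ω => ?_))
    · rw [Set.mem_ofPred_eq] at hω ⊢
      refine hω.trans (le_of_eq ?_)
      rw [Finset.sum_range]
      refine Finset.sum_congr rfl fun t _ => ?_
      simp
    · rw [Set.mem_ofPred_eq] at hω ⊢
      refine hω.trans (le_of_eq ?_)
      rw [Finset.sum_range]
      refine Finset.sum_congr rfl fun t _ => ?_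
      rw [Fintype.sum_sigma, Finset.sum_eq_single p.1]
      · simp
      · intro j _ hj
        simp [hj]
      · simp
    · by_cases h : p'.1 = p.1
      · simp only [h, if_true]
        exact R.measurable_hedge t p' m p'.1 p'.2
      · simp only [h, if_false]
        exact measurable_const
    · have hθ := hedge_mem_stdSimplex ε (R.prof (elimLength G Δ) ω) (R.payoff ω) t p.1
      rw [Fintype.sum_sigma, Finset.sum_eq_single p.1]
      · simp only [if_true]
        rw [← hθ.2]
        refine Finset.sum_le_sum fun b _ => ?_
        have hle : hedge ε (R.prof (elimLength G Δ) ω) (R.payoff ω) t p.1 b ≤ 1 := by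
          rw [← hθ.2]
          exact Finset.single_le_sum (fun b _ => hθ.1 b) (mem_univ b)
        rw [sq]
        exact mul_le_of_le_one_right (hθ.1 b) hle
      · intro j _ hj
        simp [hj]
      · simp
  · calc (Fintype.card (Σ i, A i) : ℝ) * (2 * (δ / K)) ≤ (N * maxActions A) * (2 * (δ / K)) := by
          gcongr; exact card_sigma_le A
      _ = K * (δ / K) := by rw [hK]; ring
      _ ≤ δ := (mul_div_cancel₀ δ (by positivity)).le

end Events

section Output

variable {N : ℕ} {A : Fin N → Type u} [∀ i, Fintype (A i)] {G : Game A} {ε Δ δ : ℝ} {T : ℕ}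

lemma sum_output_mul (astar : ∀ j, A j) (r : Slot G Δ δ T → ℝ) (f : (∀ j, A j) → ℝ) :
    ∑ b, output ε astar r b * f b = (∑ t ∈ range T, expect
      (fun i => clip (clipThreshold N (maxActions A) ε Δ) (hedge ε astar r t i)) f) / T := by
  unfold output expect
  rw [Finset.sum_comm, Finset.sum_div]
  refine Finset.sum_congr rfl fun b _ => ?_
  rw [← Finset.sum_mul]
  ring

/-- If Hedge plays eliminated actions with probability below the clipping threshold, the output
plays only rationalizable actions. -/
lemma output_playsRationalizable {astar : ∀ j, A j} {r : Slot G Δ δ T → ℝ}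
    (h : ∀ t < T, ∀ p ∈ elim G Δ (elimLength G Δ),
      hedge ε astar r t p.1 p.2 < clipThreshold N (maxActions A) ε Δ) :
    PlaysRationalizable G Δ (output ε astar r) := by
  intro b hb i hmem
  have hsum : ∑ t ∈ range T, ∏ i, clip (clipThreshold N (maxActions A) ε Δ)
      (hedge ε astar r t i) (b i) ≠ 0 := fun h0 => hb (by rw [output, h0, zero_div])
  obtain ⟨t, ht, hprod⟩ := Finset.exists_ne_zero_of_sum_ne_zero hsum
  have hi := Finset.prod_ne_zero_iff.1 hprod i (mem_univ i)
  exact absurd (h t (mem_range.1 ht) ⟨i, b i⟩ hmem) (not_lt.2 (le_of_clip_ne_zero hi))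

variable [∀ i, Nonempty (A i)] {astar : ∀ j, A j} {r : Slot G Δ δ T → ℝ}

lemma clip_hedge_mem_stdSimplex (H : Admissible N (maxActions A) ε Δ δ) (t : ℕ) (i : Fin N) :
    clip (clipThreshold N (maxActions A) ε Δ) (hedge ε astar r t i) ∈ stdSimplex ℝ (A i) := by
  have hθ := hedge_mem_stdSimplex ε astar r t i
  refine clip_mem_stdSimplex hθ ?_
  have h := one_sub_card_mul_le_sum_filter hθ
    (K := fun a => clipThreshold N (maxActions A) ε Δ ≤ hedge ε astar r t i a)
    (clipThreshold_pos H.one_le_players H.one_le_actions H.eps_pos H.gap_pos).le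
    (fun a h => (not_le.1 h).le) (card_le_maxActions i)
  linarith [mul_clipThreshold_le H.one_le_players H.one_le_actions H.eps_pos H.gap_pos H.eps_le_one]

lemma output_mem_stdSimplex (H : Admissible N (maxActions A) ε Δ δ) (hT : 1 ≤ T) :
    output ε astar r ∈ stdSimplex ℝ (∀ j, A j) := by
  have hc := clip_hedge_mem_stdSimplex (astar := astar) (r := r) H
  refine ⟨fun b => div_nonneg (Finset.sum_nonneg fun t _ =>
    prod_strategy_nonneg (hc t) b) (Nat.cast_nonneg _), ?_⟩
  have h := sum_output_mul (ε := ε) astar r fun _ => 1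
  have hTne : (T : ℝ) ≠ 0 := by positivity
  simp only [mul_one] at h
  rw [h]
  simp only [expect, mul_one, sum_prod_eq_one (hc _), Finset.sum_const, card_range, nsmul_eq_mul]
  exact div_self hTne

/-- If the estimation errors contribute little to the regret, the output is an `ε`-CCE. -/
lemma output_isCCE (H : Admissible N (maxActions A) ε Δ δ)
    (hT : numRounds N (maxActions A) ε Δ δ ≤ T) (hr : ∀ s, r s ∈ Set.Icc (0 : ℝ) 1)
    (h₁ : ∀ p, ∑ τ ∈ range T, (roundValue ε astar r τ p - roundPayoff r τ p)
      ≤ regretTolerance N (maxActions A) T δ)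
    (h₂ : ∀ i, ∑ τ ∈ range T, ∑ b, hedge ε astar r τ i b *
      (roundPayoff r τ ⟨i, b⟩ - roundValue ε astar r τ ⟨i, b⟩)
      ≤ regretTolerance N (maxActions A) T δ) :
    IsCCE G ε (output ε astar r) := by
  have hT1 : 1 ≤ T := H.one_le_numRounds.trans hT
  have hT0 : (0 : ℝ) < T := by exact_mod_cast hT1
  refine ⟨output_mem_stdSimplex H hT1, fun i a => ?_⟩
  have hθ := hedge_mem_stdSimplex ε astar r
  set q := clipThreshold N (maxActions A) ε Δ with hq
  have hq0 : 0 < q := clipThreshold_pos H.one_le_players H.one_le_actions H.eps_pos H.gap_pos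
  have hmq : maxActions A * q < 1 := by
    linarith [mul_clipThreshold_le H.one_le_players H.one_le_actions H.eps_pos H.gap_pos
      H.eps_le_one]
  have hNq : N * (maxActions A * q) ≤ ε / 8 := by
    rw [hq, mul_clipThreshold H.one_le_players H.one_le_actions]
    linarith [min_le_left ε Δ]
  have hclip : ∀ f : (∀ j, A j) → ℝ, (∀ b, f b ∈ Set.Icc (0 : ℝ) 1) → ∀ t,
      |expect (fun j => clip q (hedge ε astar r t j)) f - expect (hedge ε astar r t) f| ≤ ε / 8 :=
    fun f hf t => (abs_expect_clip_sub_le (hθ t) hq0.le card_le_maxActions hmq hf).trans hNq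
  have hdev : ∀ t, expect (hedge ε astar r t) (fun b => G.util i (Function.update b i a))
      = roundValue ε astar r t ⟨i, a⟩ := fun t =>
    (deviationValue_eq_expect (p := ⟨i, a⟩) (hθ t i) _).symm
  have hval : ∀ t, expect (hedge ε astar r t) (G.util i)
      = ∑ b, hedge ε astar r t i b * roundValue ε astar r t ⟨i, b⟩ := fun t =>
    (sum_mul_deviationValue _ i _).symm
  have hreg := hedge_estimated_regret_le (astar := astar) H.one_le_players H.eps_pos H.eps_le_one
    H.gap_pos hr hT1 i a
  have hbound := H.regret_bound_le hT
  have e₁ := h₁ ⟨i, a⟩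
  have e₂ := h₂ i
  rw [regretTolerance] at e₁ e₂
  rw [Finset.sum_sub_distrib] at e₁
  simp_rw [mul_sub, Finset.sum_sub_distrib] at e₂
  have htotal : ∑ t ∈ range T, roundValue ε astar r t ⟨i, a⟩
      - ∑ t ∈ range T, ∑ b, hedge ε astar r t i b * roundValue ε astar r t ⟨i, b⟩
      ≤ ε / 2 * T := by linarith
  rw [sum_output_mul, sum_output_mul, sub_le_iff_le_add, div_le_iff₀ hT0, add_mul,
    div_mul_cancel₀ _ hT0.ne']
  have f₁ : ∑ t ∈ range T, expect (fun j => clip q (hedge ε astar r t j))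
      (fun b => G.util i (Function.update b i a))
      ≤ ∑ t ∈ range T, (roundValue ε astar r t ⟨i, a⟩ + ε / 8) := by
    refine Finset.sum_le_sum fun t _ => ?_
    have := (abs_le.1 (hclip _ (fun b => G.util_mem i (Function.update b i a)) t)).2
    rw [hdev] at this
    linarith
  have f₂ : ∑ t ∈ range T, (∑ b, hedge ε astar r t i b * roundValue ε astar r t ⟨i, b⟩ - ε / 8)
      ≤ ∑ t ∈ range T, expect (fun j => clip q (hedge ε astar r t j)) (G.util i) := by
    refine Finset.sum_le_sum fun t _ => ?_
    have := (abs_le.1 (hclip _ (G.util_mem i) t)).1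
    rw [hval] at this
    linarith
  rw [Finset.sum_add_distrib, Finset.sum_const, card_range, nsmul_eq_mul] at f₁
  rw [Finset.sum_sub_distrib, Finset.sum_const, card_range, nsmul_eq_mul] at f₂
  have : 0 < ε * T := mul_pos H.eps_pos hT0
  linarith

end Output

section Main

variable {N : ℕ} {A : Fin N → Type u} [∀ i, Fintype (A i)] {G : Game A} {ε Δ δ : ℝ}

theorem sampleCount_le (G : Game A) (H : Admissible N (maxActions A) ε Δ δ) :
    (sampleCount G Δ δ (numRounds N (maxActions A) ε Δ δ) : ℝ)
      ≤ 30000 * Real.log (2 * N * maxActions A * elimLength G Δ / (ε * Δ * δ)) ^ 2 *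
        (elimLength G Δ * N * maxActions A / Δ ^ 2 + N * maxActions A / ε ^ 2) := by
  have h := H.plays_per_action_le (elimLength_spec G Δ).1
  set T := numRounds N (maxActions A) ε Δ δ with hT
  have hcount : (sampleCount G Δ δ T : ℝ) = Fintype.card (Σ i, A i) *
      (elimLength G Δ * initBatchSize N (maxActions A) (elimLength G Δ) Δ δ
        + ∑ t : Fin T, (batchSize N (maxActions A) Δ δ T (t + 1) : ℝ)) := by
    simp only [sampleCount, Slot, Fintype.card_sum, Fintype.card_prod, Fintype.card_sigma,
      Fintype.card_fin]
    push_cast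
    rw [← Finset.mul_sum]
    ring
  rw [hcount]
  calc _ ≤ (N * maxActions A : ℝ) * (30000 *
        Real.log (2 * N * maxActions A * elimLength G Δ / (ε * Δ * δ)) ^ 2 *
          (elimLength G Δ / Δ ^ 2 + 1 / ε ^ 2)) := by
        gcongr
        exact card_sigma_le A
    _ = _ := by ring

variable [∀ i, Nonempty (A i)]

theorem le_measure_success {T : ℕ} {Ω : Type v} [MeasurableSpace Ω] {μ : Measure Ω}
    [IsProbabilityMeasure μ] (H : Admissible N (maxActions A) ε Δ δ)
    (hT : numRounds N (maxActions A) ε Δ δ ≤ T) (R : Run G ε Δ δ T μ) :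
    ENNReal.ofReal (1 - 3 * δ) ≤
      μ {ω | IsCCE G ε (R.result ω) ∧ PlaysRationalizable G Δ (R.result ω)} := by
  have hT1 : 1 ≤ T := H.one_le_numRounds.trans hT
  have hδ := H.conf_pos
  by_cases hδ3 : 1 / 3 ≤ δ
  · rw [ENNReal.ofReal_of_nonpos (by linarith)]
    exact zero_le
  have hδ2 : δ ≤ 1 / 2 := by linarith
  set good := {ω | IsCCE G ε (R.result ω) ∧ PlaysRationalizable G Δ (R.result ω)} with hgood
  have hcover : (Set.univ : Set Ω)
      ⊆ good ∪ (R.initFailure ∪ R.estimateFailure ∪ R.regretFailure) := by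
    intro ω _
    by_cases hbad : ω ∈ R.initFailure ∪ R.estimateFailure ∪ R.regretFailure
    · exact Or.inr hbad
    refine Or.inl ?_
    simp only [Set.mem_union, not_or] at hbad
    obtain ⟨⟨hb₁, hb₂⟩, hb₃⟩ := hbad
    have hb₁' : ∀ l p, |initAverage (R.payoff ω) l p
        - G.util p.1 (Function.update (R.prof l ω) p.1 p.2)| < Δ / 2 := fun l p =>
      not_le.1 fun h => hb₁ (Set.mem_iUnion.2 ⟨(l, p), h⟩)
    have hstar : ∀ i, Rationalizable G Δ i (R.prof (elimLength G Δ) ω i) := fun i =>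
      bestResponse_notMem_elim (prof := fun l => R.prof l ω) hb₁'
        (fun l i a => R.prof_best l ω i a) _ le_rfl i
    have hb₃' : ∀ p : Σ i, A i, _ := fun p => not_or.1 fun h => hb₃ (Set.mem_iUnion.2 ⟨p, h⟩)
    refine ⟨output_isCCE H hT (R.payoff_mem ω) (fun p => ?_) (fun i => ?_),
      output_playsRationalizable fun t ht p hp => ?_⟩
    · exact (not_le.1 (hb₃' p).1).le
    · exact (not_le.1 (hb₃' ⟨i, Classical.arbitrary _⟩).2).le
    · refine hedge_lt_clipThreshold H.one_le_players H.eps_pos H.eps_le_one H.gap_pos H.gap_le_one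
        hstar (fun n hn hnT p => ?_) ht.le hp
      obtain ⟨k, rfl⟩ : ∃ k, n = k + 1 := ⟨n - 1, by omega⟩
      exact not_le.1 fun h => hb₂ (Set.mem_iUnion.2 ⟨(⟨k, by omega⟩, p), h⟩)
  have hone : (1 : ENNReal) ≤ μ good + ENNReal.ofReal (3 * δ) := by
    calc (1 : ENNReal) = μ Set.univ := measure_univ.symm
      _ ≤ μ (good ∪ (R.initFailure ∪ R.estimateFailure ∪ R.regretFailure)) := measure_mono hcover
      _ ≤ μ good + (μ R.initFailure + μ R.estimateFailure + μ R.regretFailure) :=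
          (measure_union_le _ _).trans (add_le_add le_rfl ((measure_union_le _ _).trans
            (add_le_add (measure_union_le _ _) le_rfl)))
      _ ≤ μ good + (ENNReal.ofReal δ + ENNReal.ofReal δ + ENNReal.ofReal δ) := by
          gcongr
          · exact R.measure_initFailure_le H hδ2
          · exact R.measure_estimateFailure_le H hδ2 hT1
          · exact R.measure_regretFailure_le H hT1
      _ = _ := by
          rw [← ENNReal.ofReal_add hδ.le hδ.le, ← ENNReal.ofReal_add (by linarith) hδ.le]
          congr 2
          ring
  rw [ENNReal.ofReal_sub _ (by linarith), ENNReal.ofReal_one]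
  exact tsub_le_iff_right.2 hone

end Main

end RationalizableCCE

end

theorem mainTheorem1 :
    ∃ (C : ℝ) (k : ℕ) (T₀ : ℕ → ℕ → ℝ → ℝ → ℝ → ℕ), 0 < C ∧
      (∀ (n m : ℕ) (ε Δ δ : ℝ), 1 ≤ n → 1 ≤ m → 0 < ε → ε ≤ 1 → 0 < Δ → Δ ≤ 1 → 0 < δ → δ < 1 →
        (T₀ n m ε Δ δ : ℝ)
          ≤ C * Real.log (2 * n * m / (ε * Δ * δ)) ^ k * (1 / ε ^ 2 + 1 / (ε * Δ))) ∧
      ∀ (N : ℕ) (A : Fin N → Type*) [∀ i, Fintype (A i)] [∀ i, Nonempty (A i)]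
        (G : RationalizableCCE.Game A) (ε Δ δ : ℝ),
        1 ≤ N → 0 < ε → ε ≤ 1 → 0 < Δ → Δ ≤ 1 → 0 < δ → δ < 1 →
        (∀ (T : ℕ), T₀ N (RationalizableCCE.maxActions A) ε Δ δ ≤ T →
          ∀ (Ω : Type*) [MeasurableSpace Ω] (μ : MeasureTheory.Measure Ω)
            [MeasureTheory.IsProbabilityMeasure μ] (R : RationalizableCCE.Run G ε Δ δ T μ),
            ENNReal.ofReal (1 - 3 * δ) ≤
              μ {ω | RationalizableCCE.IsCCE G ε (R.result ω) ∧
                RationalizableCCE.PlaysRationalizable G Δ (R.result ω)}) ∧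
        (RationalizableCCE.sampleCount G Δ δ
            (T₀ N (RationalizableCCE.maxActions A) ε Δ δ) : ℝ)
          ≤ C * Real.log (2 * N * RationalizableCCE.maxActions A * RationalizableCCE.elimLength G Δ
                / (ε * Δ * δ)) ^ k *
            (RationalizableCCE.elimLength G Δ * N * RationalizableCCE.maxActions A / Δ ^ 2
              + N * RationalizableCCE.maxActions A / ε ^ 2) := by
  refine ⟨30000, 2, RationalizableCCE.numRounds, by norm_num, ?_, ?_⟩
  · intro n m ε Δ δ hn hm hε hε1 hΔ hΔ1 hδ hδ1
    have H : RationalizableCCE.Admissible n m ε Δ δ := ⟨hn, hm, hε, hε1, hΔ, hΔ1, hδ, hδ1⟩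
    refine H.numRounds_le.trans ?_
    unfold RationalizableCCE.logFactor
    gcongr
    norm_num
  · intro N A _ _ G ε Δ δ hN hε hε1 hΔ hΔ1 hδ hδ1
    have H : RationalizableCCE.Admissible N (RationalizableCCE.maxActions A) ε Δ δ :=
      ⟨hN, RationalizableCCE.one_le_maxActions hN, hε, hε1, hΔ, hΔ1, hδ, hδ1⟩
    exact ⟨fun T hT Ω _ μ _ R => RationalizableCCE.le_measure_success H hT R,
      RationalizableCCE.sampleCount_le G H⟩
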